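/- Let $a<b$ be real, let $\alpha,\beta,\gamma\in\mathbb{C}$ have non-negative real parts, let $R>(b-a)^{\mathrm{Re}(\beta)}$, and let $A(x)=\sum_{j\ge 0}a_jx^j$ be a power series (with complex coefficients) converging on the disc $D(0,R)$. If $\mathrm{Re}(\alpha)=0$, assume moreover that the kernel $x\mapsto x^{\alpha-1}A(x^{\beta})$ is integrable on $(0,b-a)$ (this is automatic if $\mathrm{Re}(\alpha)>0$). For $g\in L^1[a,b]$ put $${}^{A}I^{\alpha,\beta}_{a+}g(t)=\int_a^t(t-\tau)^{\alpha-1}A\big((t-\tau)^{\beta}\big)g(\tau)\,d\tau ,\qquad {}^{RL}I^{\nu}_{a+}g(t)=\frac1{\Gamma(\nu)}\int_a^t(t-\tau)^{\nu-1}g(\tau)\,d\tau\quad(\mathrm{Re}(\nu)>0).$$ For $u\in L^1[a,b]$ put ${}^{RL}D^{\nu}_{a+}u=\frac{d^m}{dt^m}\,{}^{RL}I^{m-\nu}_{a+}u$ with $m=\lfloor\mathrm{Re}(\nu)\rfloor+1$ if $\mathrm{Re}(\nu)\ge 0$; this is said to exist when ${}^{RL}I^{m-\nu}_{a+}u$ agrees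 almost everywhere on $[a,b]$ with a function $v\in AC^m[a,b]$ (that is, $v\in C^{m-1}[a,b]$ with $v^{(m-1)}$ absolutely continuous), and is then the almost everywhere defined function $v^{(m)}$. Put ${}^{RL}D^{\nu}_{a+}u={}^{RL}I^{-\nu}_{a+}u$ if $\mathrm{Re}(\nu)<0$. Let $n=\lceil\mathrm{Re}(\gamma)\rceil$ and $C_1,\dots,C_n\in\mathbb{C}$. Let $f:[a,b]\times\mathbb{C}\to\mathbb{C}$ be such that $t\mapsto f(t,u(t))$ is in $L^1[a,b]$ for every $u\in L^1[a,b]$, and suppose that for some constant $C$ $$|f(t,y_1)-f(t,y_2)|\le C|y_1-y_2|\qquad\text{for all }t\in[a,b],\ y_1,y_2\in\mathbb{C}.$$ Then the Cauchy problem $${}^{RL}D^{\gamma}_{a+}u(t)={}^{A}I^{\alpha,\beta}_{a+}f(t,u(t))\quad\text{for a.e. }t\in[a,b],\qquad \lim_{t\to a^+}{}^{RL}D^{\gamma-k}_{a+}u(t)=C_k,\quad k=1,\dots,n$$ (the limit being that of a suitable representative of ${}^{RL}D^{\gamma-k}_{a+}u$) has a unique solution $u\in L^1([a,b];\mathbb{C})$,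 where functions equal almost everywhere are identified. If moreover $\alpha,\beta,\gamma$, all the coefficients $a_j$ and the constants $C_1,\dots,C_n$ are real, then for every $f:[a,b]\times\mathbb{R}\to\mathbb{R}$ satisfying the same two assumptions with $\mathbb{R}$ in place of $\mathbb{C}$, the Cauchy problem has a unique solution $u\in L^1([a,b];\mathbb{R})$. -/

import Mathlib

open MeasureTheory Set Filter Topology

noncomputable section

/-- The kernel `x ↦ x ^ (α - 1) * A (x ^ β)` of the generalised fractional integral
(principal powers; only `x > 0` matters). -/
def genKernel (A : ℂ → ℂ) (α β : ℂ) (x : ℝ) : ℂ :=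
  (x : ℂ) ^ (α - 1) * A ((x : ℂ) ^ β)

/-- The generalised fractional integral
`I^{α,β}_{A,a+} g (t) = ∫_a^t (t-τ)^(α-1) A((t-τ)^β) g(τ) dτ`. -/
def genInt (A : ℂ → ℂ) (a : ℝ) (α β : ℂ) (g : ℝ → ℂ) (t : ℝ) : ℂ :=
  ∫ τ in a..t, genKernel A α β (t - τ) * g τ

/-- The Riemann-Liouville integral of order `ν`, `Re ν > 0`:
`I^ν_{a+} g (t) = Γ(ν)⁻¹ ∫_a^t (t-τ)^(ν-1) g(τ) dτ`. -/
def rlInt (a : ℝ) (ν : ℂ) (g : ℝ → ℂ) (t : ℝ) : ℂ :=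
  (Complex.Gamma ν)⁻¹ * ∫ τ in a..t, ((t - τ : ℝ) : ℂ) ^ (ν - 1) * g τ

/-- `v` belongs to `AC^{l+1}[a,b]`: it is `l` times continuously differentiable on `[a,b]`
and its `l`-th derivative is absolutely continuous there. -/
def MemACSucc (a b : ℝ) (l : ℕ) (v : ℝ → ℂ) : Prop :=
  ContDiffOn ℝ (l : ℕ) v (Icc a b) ∧
    AbsolutelyContinuousOnInterval (iteratedDerivWithin l v (Icc a b)) a b

/-- `w` is (almost everywhere on `[a,b]`) the Riemann-Liouville differintegral `D^ν_{a+} u` of the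
integrable function `u`.

* If `Re ν ≥ 0`, then `D^ν u = (d/dt)^m I^{m-ν} u` with `m = ⌊Re ν⌋ + 1`: the function `I^{m-ν} u`,
  which is defined almost everywhere, has a representative `v` in `AC^m[a,b]`, and
  `w` is its `m`-th derivative almost everywhere.
* If `Re ν < 0`, then `D^ν u = I^{-ν} u`. -/
def IsRLDeriv (a b : ℝ) (ν : ℂ) (u w : ℝ → ℂ) : Prop :=
  (0 ≤ ν.re → ∃ v : ℝ → ℂ,
    MemACSucc a b ⌊ν.re⌋₊ v ∧
    v =ᵐ[volume.restrict (Icc a b)] rlInt a (((⌊ν.re⌋₊ + 1 : ℕ) : ℂ) - ν) u ∧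
    w =ᵐ[volume.restrict (Icc a b)] iteratedDerivWithin (⌊ν.re⌋₊ + 1) v (Icc a b)) ∧
  (ν.re < 0 → w =ᵐ[volume.restrict (Icc a b)] rlInt a (-ν) u)

/-- `u` solves the Cauchy problem `D^γ_{a+} u (t) = I^{α,β}_{A,a+} f(t,u(t))` almost everywhere on
`[a,b]`, with initial values `D^{γ-k}_{a+} u (t) → C_k` as `t → a+` for `k = 1, …, n`, where
`n = ⌈Re γ⌉`. As `u` is only determined almost everywhere, the limit is that of a
representative of `D^{γ-k}_{a+} u`. -/
def IsCauchySolution (a b : ℝ) (A : ℂ → ℂ) (α β γ : ℂ) (C : ℕ → ℂ) (f : ℝ → ℂ → ℂ)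
    (u : ℝ → ℂ) : Prop :=
  IsRLDeriv a b γ u (genInt A a α β (fun t => f t (u t))) ∧
  ∀ k ∈ Finset.Icc 1 ⌈γ.re⌉₊, ∃ w : ℝ → ℂ,
    IsRLDeriv a b (γ - (k : ℂ)) u w ∧ Tendsto w (𝓝[>] a) (𝓝 (C k))

end

/-! ### Volterra convolution on an interval -/

noncomputable section

/-! Put m = ⌊Re γ⌋ + 1, let k be the kernel x^(α-1) A(x^β), let * be Volterra convolution and w = k
* f(·,u). The Cauchy problem says that I^(m-γ) u has a representative in AC^m with m-th derivative w
and prescribed derivatives at a. By absolute continuity this means that I^(m-γ) u is an m-fold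
primitive of w, that is I^m w plus a polynomial built from the C_j (`isCauchySolution_iff_rlInt`,
`iterPrim_ae_eq`). If Re γ is an integer, only m - 1 values are prescribed, but the missing one is
forced to be 0.

Both summands lie in the range of I^(m-γ). By the Beta integral the polynomial is the image of φ = Σ
C_j (t-a)^(γ-j) / Γ(γ-j+1), and I^m k = I^(m-γ) K with K = Σ c_n Γ(α+βn)/Γ(α+βn+γ) x^(α+βn+γ-1) when
Re α > 0 (`exists_kernel_of_hasSum`). The Gamma quotient grows at most linearly in n, so K is
integrable. If Re α = 0, integrability of k either kills c_0, which lets α + β replace α, or makes k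
vanish almost everywhere (`exists_kernel`).

Since I^(m-γ) is injective on L^1, the problem is equivalent to u = φ + K * f(·,u)
(`rlInt_ae_eq_iterPrim_iff`). A weight e^(-nt) with n large turns this into a fixed point equation
for a contraction of L^1 (`exists_volterra_solution`). For real data φ, K and f are real, hence so
is u. -/

/-- The Volterra convolution `t ↦ ∫_a^t k(t-τ) g(τ) dτ`. -/
def volterra (a : ℝ) (k g : ℝ → ℂ) (t : ℝ) : ℂ :=
  ∫ τ in a..t, k (t - τ) * g τ

open scoped Convolution

/-- Convolution on the line of the truncations of a kernel and a function. -/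
def truncConv (a b : ℝ) (k g : ℝ → ℂ) : ℝ → ℂ :=
  (Ioc 0 (b - a)).indicator k ⋆[ContinuousLinearMap.mul ℝ ℂ] (Ioc a b).indicator g

theorem truncConv_apply (a b : ℝ) (k g : ℝ → ℂ) (t : ℝ) :
    truncConv a b k g t =
      ∫ τ, (Ioc 0 (b - a)).indicator k (t - τ) * (Ioc a b).indicator g τ := by
  rw [truncConv, convolution_eq_swap]; rfl

/-- For a < t ≤ b the two truncations together leave exactly the τ between a and t, up to a null
set. This gives access to the convolution theory of the whole line. -/
theorem truncConv_eq_volterra {a b : ℝ} (k g : ℝ → ℂ) {t : ℝ} (ht : t ∈ Ioc a b) :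
    truncConv a b k g t = volterra a k g t := by
  rw [truncConv_apply, volterra, intervalIntegral.integral_of_le ht.1.le,
    integral_Ioc_eq_integral_Ioo, ← integral_indicator measurableSet_Ioo]
  congr 1 with τ
  by_cases h : τ ∈ Ioo a t
  · have h1 : t - τ ∈ Ioc 0 (b - a) := ⟨by linarith [h.2], by linarith [h.1, ht.2]⟩
    have h2 : τ ∈ Ioc a b := ⟨h.1, by linarith [h.2, ht.2]⟩
    simp [h, h1, h2]
  · rw [indicator_of_notMem h]
    by_cases h2 : τ ∈ Ioc a b
    · have h1 : t - τ ∉ Ioc 0 (b - a) := fun h1 => h ⟨h2.1, by linarith [h1.1]⟩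
      simp [h1]
    · simp [h2]

theorem truncConv_eq_zero {a b : ℝ} (k g : ℝ → ℂ) {t : ℝ} (ht : t ≤ a) :
    truncConv a b k g t = 0 := by
  rw [truncConv_apply]
  convert integral_zero ℝ ℂ with τ
  by_cases h2 : τ ∈ Ioc a b
  · have h1 : t - τ ∉ Ioc 0 (b - a) := fun h1 => by linarith [h1.1, h2.1]
    simp [h1]
  · simp [h2]

theorem indicator_volterra {a b : ℝ} (k g : ℝ → ℂ) {t : ℝ} (ht : t ≤ b) :
    (Ioc a b).indicator (volterra a k g) t = truncConv a b k g t := by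
  by_cases h : a < t
  · rw [indicator_of_mem (show t ∈ Ioc a b from ⟨h, ht⟩), truncConv_eq_volterra k g ⟨h, ht⟩]
  · rw [indicator_of_notMem (fun h' => h h'.1), truncConv_eq_zero k g (not_lt.1 h)]

theorem integrable_truncConv {a b : ℝ} {k g : ℝ → ℂ} (hk : IntegrableOn k (Ioc 0 (b - a)))
    (hg : IntegrableOn g (Ioc a b)) : Integrable (truncConv a b k g) :=
  Integrable.integrable_convolution _ (hk.integrable_indicator measurableSet_Ioc)
    (hg.integrable_indicator measurableSet_Ioc)

theorem integrableOn_volterra {a b : ℝ} {k g : ℝ → ℂ} (hk : IntegrableOn k (Ioc 0 (b - a)))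
    (hg : IntegrableOn g (Ioc a b)) : IntegrableOn (volterra a k g) (Ioc a b) :=
  (integrable_truncConv hk hg).integrableOn.congr_fun
    (fun _ ht => truncConv_eq_volterra k g ht) measurableSet_Ioc

/-- Young's inequality: the integral of the convolution of the two norms is the product of their
integrals. -/
theorem integral_norm_volterra_le {a b : ℝ} {k g : ℝ → ℂ} (hk : IntegrableOn k (Ioc 0 (b - a)))
    (hg : IntegrableOn g (Ioc a b)) :
    ∫ t in Ioc a b, ‖volterra a k g t‖ ≤
      (∫ x in Ioc 0 (b - a), ‖k x‖) * ∫ t in Ioc a b, ‖g t‖ := by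
  have hk' := hk.integrable_indicator measurableSet_Ioc
  have hg' := hg.integrable_indicator measurableSet_Ioc
  have h1 : ∫ t in Ioc a b, ‖volterra a k g t‖ ≤ ∫ t, ‖truncConv a b k g t‖ := by
    rw [setIntegral_congr_fun (g := fun t => ‖truncConv a b k g t‖) measurableSet_Ioc
      (fun t ht => by simp only [truncConv_eq_volterra k g ht])]
    exact setIntegral_le_integral (integrable_truncConv hk hg).norm
      (Eventually.of_forall fun _ => norm_nonneg _)
  refine h1.trans ?_
  have h2 := integral_convolution (μ := volume) (ν := volume) (ContinuousLinearMap.mul ℝ ℝ)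
    hk'.norm hg'.norm
  rw [ContinuousLinearMap.mul_apply'] at h2
  have e1 : ∫ x, ‖(Ioc 0 (b - a)).indicator k x‖ = ∫ x in Ioc 0 (b - a), ‖k x‖ := by
    rw [← integral_indicator measurableSet_Ioc]
    simp only [norm_indicator_eq_indicator_norm]
  have e2 : ∫ x, ‖(Ioc a b).indicator g x‖ = ∫ x in Ioc a b, ‖g x‖ := by
    rw [← integral_indicator measurableSet_Ioc]
    simp only [norm_indicator_eq_indicator_norm]
  rw [e1, e2] at h2
  rw [← h2]
  refine integral_mono (integrable_truncConv hk hg).norm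
    (Integrable.integrable_convolution _ hk'.norm hg'.norm) fun t => ?_
  refine (norm_integral_le_integral_norm _).trans (le_of_eq ?_)
  simp [convolution_def]

theorem ae_integrable_volterra {a b : ℝ} {k g : ℝ → ℂ} (hk : IntegrableOn k (Ioc 0 (b - a)))
    (hg : IntegrableOn g (Ioc a b)) :
    ∀ᵐ t ∂volume.restrict (Ioc a b),
      IntervalIntegrable (fun τ => k (t - τ) * g τ) volume a t := by
  have hk' := hk.integrable_indicator measurableSet_Ioc
  have hg' := hg.integrable_indicator measurableSet_Ioc
  have := Integrable.ae_convolution_exists (ContinuousLinearMap.mul ℝ ℂ) hk' hg'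
  rw [ae_restrict_iff' measurableSet_Ioc]
  filter_upwards [this] with t h ht
  have h := h.integrable_swap
  rw [intervalIntegrable_iff_integrableOn_Ioo_of_le ht.1.le]
  refine h.integrableOn.congr_fun (fun τ hτ => ?_) measurableSet_Ioo
  have h1 : t - τ ∈ Ioc 0 (b - a) := ⟨by linarith [hτ.2], by linarith [hτ.1, ht.2]⟩
  have h2 : τ ∈ Ioc a b := ⟨hτ.1, by linarith [hτ.2, ht.2]⟩
  simp [h1, h2]

/-- Associativity of convolution on the line, valid wherever the triple integral converges
absolutely. The truncated inner convolutions may be nonzero to the right of the interval, but for t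
≤ b the outer factor vanishes whenever they would be evaluated there. -/
theorem volterra_assoc {a b : ℝ} {k l g : ℝ → ℂ} (hk : IntegrableOn k (Ioc 0 (b - a)))
    (hl : IntegrableOn l (Ioc 0 (b - a))) (hg : IntegrableOn g (Ioc a b)) :
    volterra a k (volterra a l g) =ᵐ[volume.restrict (Ioc a b)]
      volterra a (volterra 0 k l) g := by
  have hk' := hk.integrable_indicator measurableSet_Ioc
  have hl' := hl.integrable_indicator measurableSet_Ioc
  have hg' := hg.integrable_indicator measurableSet_Ioc
  have e3 := Integrable.ae_convolution_exists (ContinuousLinearMap.mul ℝ ℝ) hk'.norm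
    (Integrable.integrable_convolution (ContinuousLinearMap.mul ℝ ℝ) hl'.norm hg'.norm)
  rw [EventuallyEq, ae_restrict_iff' measurableSet_Ioc]
  filter_upwards [e3] with t h3 ht
  have key := convolution_assoc (ContinuousLinearMap.mul ℝ ℂ) (ContinuousLinearMap.mul ℝ ℂ)
    (ContinuousLinearMap.mul ℝ ℂ) (ContinuousLinearMap.mul ℝ ℂ)
    (fun x y z => by simp [mul_assoc]) hk'.aestronglyMeasurable
    hl'.aestronglyMeasurable hg'.aestronglyMeasurable
    (Integrable.ae_convolution_exists (ContinuousLinearMap.mul ℝ ℂ) hk' hl')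
    (Integrable.ae_convolution_exists (ContinuousLinearMap.mul ℝ ℝ) hl'.norm hg'.norm) h3
  rw [← truncConv_eq_volterra _ _ ht, ← truncConv_eq_volterra _ _ ht]
  refine Eq.trans ?_ (key.symm.trans ?_)
  · rw [truncConv_apply, convolution_eq_swap]
    refine integral_congr_ae (Eventually.of_forall fun τ => ?_)
    simp only [ContinuousLinearMap.mul_apply']
    by_cases h : t - τ ∈ Ioc 0 (b - a)
    · rw [indicator_volterra _ _ (by linarith [h.1, ht.2])]
      rfl
    · simp [h]
  · rw [truncConv_apply, convolution_eq_swap]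
    refine integral_congr_ae (Eventually.of_forall fun τ => ?_)
    simp only [ContinuousLinearMap.mul_apply']
    by_cases h : τ ∈ Ioc a b
    · rw [indicator_volterra _ _ (by linarith [h.1, ht.2]), truncConv]
      simp only [sub_zero]
    · simp [h]

theorem volterra_congr_right {a b : ℝ} (k : ℝ → ℂ) {g h : ℝ → ℂ}
    (hgh : g =ᵐ[volume.restrict (Ioc a b)] h) {t : ℝ} (ht : t ∈ Icc a b) :
    volterra a k g t = volterra a k h t := by
  rw [volterra, volterra, intervalIntegral.integral_of_le ht.1,
    intervalIntegral.integral_of_le ht.1]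
  refine integral_congr_ae ?_
  filter_upwards [ae_restrict_of_ae_restrict_of_subset (Ioc_subset_Ioc_right ht.2) hgh] with τ hτ
  rw [hτ]

theorem volterra_congr_left {a b : ℝ} {k l : ℝ → ℂ} (g : ℝ → ℂ)
    (hkl : k =ᵐ[volume.restrict (Ioc 0 (b - a))] l) {t : ℝ} (ht : t ∈ Icc a b) :
    volterra a k g t = volterra a l g t := by
  have hz (k : ℝ → ℂ) : volterra a k g t = ∫ x in (0 : ℝ)..(t - a), k x * g (t - x) := by
    have := intervalIntegral.integral_comp_sub_left (fun x => k x * g (t - x)) (a := a) (b := t) t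
    simpa [volterra] using this
  rw [hz, hz, intervalIntegral.integral_of_le (by linarith [ht.1]),
    intervalIntegral.integral_of_le (by linarith [ht.1])]
  refine integral_congr_ae ?_
  filter_upwards [ae_restrict_of_ae_restrict_of_subset
    (Ioc_subset_Ioc_right (by linarith [ht.2])) hkl] with τ hτ
  rw [hτ]

theorem volterra_add {a b : ℝ} {k g h : ℝ → ℂ} (hk : IntegrableOn k (Ioc 0 (b - a)))
    (hg : IntegrableOn g (Ioc a b)) (hh : IntegrableOn h (Ioc a b)) :
    volterra a k (fun t => g t + h t) =ᵐ[volume.restrict (Ioc a b)]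
      fun t => volterra a k g t + volterra a k h t := by
  filter_upwards [ae_integrable_volterra hk hg, ae_integrable_volterra hk hh] with t h1 h2
  simp only [volterra, mul_add]
  exact intervalIntegral.integral_add h1 h2

theorem volterra_sub {a b : ℝ} {k g h : ℝ → ℂ} (hk : IntegrableOn k (Ioc 0 (b - a)))
    (hg : IntegrableOn g (Ioc a b)) (hh : IntegrableOn h (Ioc a b)) :
    volterra a k (fun t => g t - h t) =ᵐ[volume.restrict (Ioc a b)]
      fun t => volterra a k g t - volterra a k h t := by
  filter_upwards [ae_integrable_volterra hk hg, ae_integrable_volterra hk hh] with t h1 h2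
  simp only [volterra, mul_sub]
  exact intervalIntegral.integral_sub h1 h2

theorem volterra_const_mul (a : ℝ) (k g : ℝ → ℂ) (c : ℂ) (t : ℝ) :
    volterra a k (fun t => c * g t) t = c * volterra a k g t := by
  simp only [volterra, ← intervalIntegral.integral_const_mul, mul_left_comm]

end

/-! ### Riemann-Liouville kernels: semigroup law and injectivity -/

noncomputable section

/-- The Riemann-Liouville kernel `x ^ (ν - 1) / Γ(ν)`. -/
def rlKernel (ν : ℂ) (x : ℝ) : ℂ := (Complex.Gamma ν)⁻¹ * (x : ℂ) ^ (ν - 1)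

theorem rlInt_eq_volterra (a : ℝ) (ν : ℂ) (g : ℝ → ℂ) :
    rlInt a ν g = volterra a (rlKernel ν) g := by
  ext t
  simp only [rlInt, volterra, rlKernel, ← intervalIntegral.integral_const_mul, mul_assoc]

theorem integrableOn_cpow_sub_one {z : ℂ} (hz : 0 < z.re) (T : ℝ) :
    IntegrableOn (fun x : ℝ => (x : ℂ) ^ (z - 1)) (Ioc 0 T) := by
  rcases le_total 0 T with hT | hT
  · rw [← intervalIntegrable_iff_integrableOn_Ioc_of_le hT]
    exact intervalIntegral.intervalIntegrable_cpow' (by simpa using hz)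
  · simp [Ioc_eq_empty (not_lt.2 hT)]

theorem integrableOn_rlKernel {ν : ℂ} (hν : 0 < ν.re) (T : ℝ) :
    IntegrableOn (rlKernel ν) (Ioc 0 T) :=
  (integrableOn_cpow_sub_one hν T).const_mul _

/-- This is the rescaled Beta integral together with B(z,ν) Γ(z+ν) = Γ(z) Γ(ν). -/
theorem volterra_rlKernel_cpow {ν z : ℂ} (hν : 0 < ν.re) (hz : 0 < z.re) {x : ℝ} (hx : 0 < x) :
    volterra 0 (rlKernel ν) (fun s => (s : ℂ) ^ (z - 1)) x =
      Complex.Gamma z * rlKernel (ν + z) x := by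
  have h1 := Complex.betaIntegral_scaled z ν hx
  have h2 := Complex.Gamma_mul_Gamma_eq_betaIntegral hz hν
  have h3 : volterra 0 (rlKernel ν) (fun s => (s : ℂ) ^ (z - 1)) x =
      (Complex.Gamma ν)⁻¹ * ∫ s in (0 : ℝ)..x, (s : ℂ) ^ (z - 1) * ((x : ℂ) - s) ^ (ν - 1) := by
    rw [volterra, ← intervalIntegral.integral_const_mul]
    refine intervalIntegral.integral_congr fun s _ => ?_
    simp only [rlKernel]
    push_cast
    ring
  have hΓ := Complex.Gamma_ne_zero_of_re_pos hν
  have hΓ' : Complex.Gamma (z + ν) ≠ 0 :=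
    Complex.Gamma_ne_zero_of_re_pos (by rw [Complex.add_re]; linarith)
  rw [h3, h1, rlKernel, add_comm ν z]
  field_simp
  linear_combination -h2 * (x : ℂ) ^ (z + ν - 1)

theorem volterra_rlKernel_rlKernel {ν z : ℂ} (hν : 0 < ν.re) (hz : 0 < z.re) {x : ℝ}
    (hx : 0 < x) : volterra 0 (rlKernel ν) (rlKernel z) x = rlKernel (ν + z) x := by
  have := volterra_const_mul 0 (rlKernel ν) (fun s => (s : ℂ) ^ (z - 1)) (Complex.Gamma z)⁻¹ x
  rw [volterra_rlKernel_cpow hν hz hx,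
    inv_mul_cancel_left₀ (Complex.Gamma_ne_zero_of_re_pos hz)] at this
  exact this

theorem volterra_comp_sub (a : ℝ) (k g : ℝ → ℂ) (t : ℝ) :
    volterra a k (fun t => g (t - a)) t = volterra 0 k g (t - a) := by
  have := intervalIntegral.integral_comp_sub_right (fun x => k (t - a - x) * g x)
    (a := a) (b := t) a
  rw [volterra, volterra, ← sub_self a, ← this]
  simp

theorem volterra_rlKernel_one (a : ℝ) (g : ℝ → ℂ) (t : ℝ) :
    volterra a (rlKernel 1) g t = ∫ τ in a..t, g τ := by
  simp [volterra, rlKernel]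

theorem volterra_rlKernel_comp {a b : ℝ} {μ ν : ℂ} (hμ : 0 < μ.re) (hν : 0 < ν.re)
    {g : ℝ → ℂ} (hg : IntegrableOn g (Ioc a b)) :
    volterra a (rlKernel μ) (volterra a (rlKernel ν) g) =ᵐ[volume.restrict (Ioc a b)]
      volterra a (rlKernel (μ + ν)) g := by
  refine (volterra_assoc (integrableOn_rlKernel hμ _) (integrableOn_rlKernel hν _) hg).trans ?_
  filter_upwards [ae_restrict_mem measurableSet_Ioc] with t ht
  refine volterra_congr_left _ ?_ (Ioc_subset_Icc_self ht)
  filter_upwards [ae_restrict_mem measurableSet_Ioc] with x hx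
  exact volterra_rlKernel_rlKernel hμ hν hx.1

theorem intervalIntegrable_of_integrableOn_Ioc {a b : ℝ} {g : ℝ → ℂ}
    (hg : IntegrableOn g (Ioc a b)) {t : ℝ} (ht : t ∈ Icc a b) :
    IntervalIntegrable g volume a t :=
  (intervalIntegrable_iff_integrableOn_Ioc_of_le ht.1).2
    (hg.mono_set (Ioc_subset_Ioc_right ht.2))

/-- The primitive is continuous, so it vanishes everywhere; Lebesgue differentiation then recovers
u. -/
theorem ae_eq_zero_of_integral_ae_eq_zero {a b : ℝ} (hab : a < b) {u : ℝ → ℂ}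
    (hu : IntegrableOn u (Ioc a b))
    (h : (fun t => ∫ τ in a..t, u τ) =ᵐ[volume.restrict (Ioc a b)] 0) :
    u =ᵐ[volume.restrict (Ioc a b)] 0 := by
  have hi := intervalIntegrable_of_integrableOn_Ioc hu (right_mem_Icc.2 hab.le)
  have hc : ContinuousOn (fun t => ∫ τ in a..t, u τ) (Icc a b) := by
    have := intervalIntegral.continuousOn_primitive_interval' hi left_mem_uIcc
    rwa [uIcc_of_le hab.le] at this
  have h0 : EqOn (fun t => ∫ τ in a..t, u τ) 0 (Icc a b) := by
    refine Measure.eqOn_Icc_of_ae_eq volume hab.ne ?_ hc continuousOn_const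
    rwa [← Measure.restrict_congr_set Ioc_ae_eq_Icc]
  rw [Measure.restrict_congr_set Ioo_ae_eq_Ioc.symm, EventuallyEq, ae_restrict_iff' measurableSet_Ioo]
  filter_upwards [hi.ae_hasDerivAt_integral] with x hx hxI
  have h1 := hx (by rw [uIcc_of_le hab.le]; exact Ioo_subset_Icc_self hxI) a left_mem_uIcc
  have h2 : (fun t => ∫ τ in a..t, u τ) =ᶠ[𝓝 x] fun _ => 0 := by
    filter_upwards [Icc_mem_nhds hxI.1 hxI.2] with t ht using h0 ht
  exact h1.unique ((hasDerivAt_const x (0 : ℂ)).congr_of_eventuallyEq h2)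

theorem ae_eq_zero_of_volterra_rlKernel_nat {a b : ℝ} (hab : a < b) (n : ℕ) {u : ℝ → ℂ}
    (hu : IntegrableOn u (Ioc a b))
    (h : volterra a (rlKernel ((n : ℂ) + 1)) u =ᵐ[volume.restrict (Ioc a b)] 0) :
    u =ᵐ[volume.restrict (Ioc a b)] 0 := by
  induction n with
  | zero =>
    refine ae_eq_zero_of_integral_ae_eq_zero hab hu ?_
    filter_upwards [h] with t ht
    simpa [volterra_rlKernel_one] using ht
  | succ n ih =>
    have hn : 0 < ((n : ℂ) + 1).re := by simp; positivity
    refine ih (ae_eq_zero_of_integral_ae_eq_zero hab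
      (integrableOn_volterra (integrableOn_rlKernel hn _) hu) ?_)
    filter_upwards [h, volterra_rlKernel_comp (μ := 1) (by simp) hn hu] with t h1 h2
    rw [← volterra_rlKernel_one, h2, ← h1]
    congr 2
    push_cast
    ring

/-- Applying I^(n+1-ν) raises the order to the integer n + 1, where injectivity follows by repeated
differentiation. -/
theorem ae_eq_zero_of_volterra_rlKernel {a b : ℝ} (hab : a < b) {ν : ℂ} (hν : 0 < ν.re)
    {u : ℝ → ℂ} (hu : IntegrableOn u (Ioc a b))
    (h : volterra a (rlKernel ν) u =ᵐ[volume.restrict (Ioc a b)] 0) :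
    u =ᵐ[volume.restrict (Ioc a b)] 0 := by
  obtain ⟨n, hn⟩ := exists_nat_gt ν.re
  have hμ : 0 < ((n : ℂ) + 1 - ν).re := by simp; linarith
  refine ae_eq_zero_of_volterra_rlKernel_nat hab n hu ?_
  filter_upwards [volterra_rlKernel_comp hμ hν hu, ae_restrict_mem measurableSet_Ioc] with t h1 ht
  rw [sub_add_cancel] at h1
  rw [← h1, volterra_congr_right _ h (Ioc_subset_Icc_self ht)]
  simp [volterra]

theorem ae_eq_of_volterra_rlKernel {a b : ℝ} (hab : a < b) {ν : ℂ} (hν : 0 < ν.re)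
    {u v : ℝ → ℂ} (hu : IntegrableOn u (Ioc a b)) (hv : IntegrableOn v (Ioc a b))
    (h : volterra a (rlKernel ν) u =ᵐ[volume.restrict (Ioc a b)] volterra a (rlKernel ν) v) :
    u =ᵐ[volume.restrict (Ioc a b)] v := by
  have := ae_eq_zero_of_volterra_rlKernel hab hν (u := fun t => u t - v t) (hu.sub hv) (by
    filter_upwards [h, volterra_sub (integrableOn_rlKernel hν _) hu hv] with t h1 h2
    rw [h2, h1]; simp)
  filter_upwards [this] with t ht
  exact sub_eq_zero.1 ht

end

/-! ### Initial polynomials, iterated primitives and AC^m -/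

noncomputable section

theorem volterra_finset_sum {ι : Type*} {a b : ℝ} {k : ℝ → ℂ} (s : Finset ι) {g : ι → ℝ → ℂ}
    (hk : IntegrableOn k (Ioc 0 (b - a))) (hg : ∀ i ∈ s, IntegrableOn (g i) (Ioc a b)) :
    volterra a k (fun t => ∑ i ∈ s, g i t) =ᵐ[volume.restrict (Ioc a b)]
      fun t => ∑ i ∈ s, volterra a k (g i) t := by
  classical
  induction s using Finset.induction_on with
  | empty => exact Eventually.of_forall fun t => by simp [volterra]
  | insert i s his ih =>
    have h1 := hg i (Finset.mem_insert_self i s)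
    have h2 : ∀ j ∈ s, IntegrableOn (g j) (Ioc a b) :=
      fun j hj => hg j (Finset.mem_insert_of_mem hj)
    have h3 : IntegrableOn (fun t => ∑ j ∈ s, g j t) (Ioc a b) :=
      integrable_finsetSum s h2
    simp only [Finset.sum_insert his]
    filter_upwards [ih h2, volterra_add hk h1 h3] with t e1 e2
    rw [e2, e1]

theorem integrableOn_comp_sub {a b : ℝ} {k : ℝ → ℂ} (hk : IntegrableOn k (Ioc 0 (b - a))) :
    IntegrableOn (fun t => k (t - a)) (Ioc a b) := by
  rcases le_total a b with hab | hab
  · rw [← intervalIntegrable_iff_integrableOn_Ioc_of_le (by linarith)] at hk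
    rw [← intervalIntegrable_iff_integrableOn_Ioc_of_le hab]
    simpa using hk.comp_sub_right a
  · simp [Ioc_eq_empty (not_lt.2 hab)]

/-- The function `∑_{k < n} d_{k+1} (t-a)^{ζ-k-1} / Γ(ζ-k)`. -/
def initialPart (a : ℝ) (n : ℕ) (d : ℕ → ℂ) (ζ : ℂ) (t : ℝ) : ℂ :=
  ∑ k ∈ Finset.range n, d (k + 1) * rlKernel (ζ - k) (t - a)

theorem integrableOn_initialPart {a : ℝ} (b : ℝ) {n : ℕ} (d : ℕ → ℂ) {ζ : ℂ}
    (hζ : (n : ℝ) - 1 < ζ.re) : IntegrableOn (initialPart a n d ζ) (Ioc a b) := by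
  refine integrable_finsetSum _ fun k hk => Integrable.const_mul
    (integrableOn_comp_sub (integrableOn_rlKernel ?_ _)) _
  have : (k : ℝ) + 1 ≤ n := by exact_mod_cast Finset.mem_range.1 hk
  simp
  linarith

theorem volterra_rlKernel_initialPart {a : ℝ} (b : ℝ) {n : ℕ} (d : ℕ → ℂ) {μ ζ : ℂ}
    (hμ : 0 < μ.re) (hζ : (n : ℝ) - 1 < ζ.re) :
    volterra a (rlKernel μ) (initialPart a n d ζ) =ᵐ[volume.restrict (Ioc a b)]
      initialPart a n d (μ + ζ) := by
  have hk : ∀ k ∈ Finset.range n, 0 < (ζ - k).re := fun k hk => by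
    have : (k : ℝ) + 1 ≤ n := by exact_mod_cast Finset.mem_range.1 hk
    simp
    linarith
  filter_upwards [volterra_finset_sum (Finset.range n) (integrableOn_rlKernel hμ (b - a))
    (g := fun k t => d (k + 1) * rlKernel (ζ - k) (t - a)) (fun k h => Integrable.const_mul
    (integrableOn_comp_sub (integrableOn_rlKernel (hk k h) _)) _),
    ae_restrict_mem measurableSet_Ioc] with t h ht
  refine h.trans (Finset.sum_congr rfl fun k hk' => ?_)
  rw [volterra_const_mul a (rlKernel μ) (fun t => rlKernel (ζ - k) (t - a)),
    volterra_comp_sub, volterra_rlKernel_rlKernel hμ (hk k hk') (sub_pos.2 ht.1), add_sub_assoc]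

/-- The `j`-fold primitive of `w` whose successive values at `a` are given by `d`. -/
def iterPrim (a : ℝ) (d : ℕ → ℂ) (w : ℝ → ℂ) : ℕ → ℝ → ℂ
  | 0 => w
  | j + 1 => fun t => d (j + 1) + ∫ τ in a..t, iterPrim a d w j τ

theorem iterPrim_succ_apply (a : ℝ) (d : ℕ → ℂ) (w : ℝ → ℂ) (j : ℕ) (t : ℝ) :
    iterPrim a d w (j + 1) t = d (j + 1) + ∫ τ in a..t, iterPrim a d w j τ := rfl

/-- The increments are dominated by those of the primitive of ‖g‖, which is absolutely continuous.
-/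
theorem absolutelyContinuousOnInterval_primitive {a b : ℝ} (hab : a ≤ b) {g : ℝ → ℂ}
    (hg : IntegrableOn g (Ioc a b)) (c : ℂ) :
    AbsolutelyContinuousOnInterval (fun t => c + ∫ τ in a..t, g τ) a b := by
  have hi := intervalIntegrable_of_integrableOn_Ioc hg (right_mem_Icc.2 hab)
  have hG := hi.norm.absolutelyContinuousOnInterval_intervalIntegral (c := a) left_mem_uIcc
  refine squeeze_zero' (Eventually.of_forall fun E => Finset.sum_nonneg fun i _ => dist_nonneg) ?_ hG
  rw [eventually_inf_principal]
  refine Eventually.of_forall fun E hE => Finset.sum_le_sum fun i hi' => ?_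
  have h1 := hE.1 i hi'
  have hx : ∀ x ∈ uIcc a b, IntervalIntegrable g volume a x := fun x hx =>
    hi.mono_set (uIcc_subset_uIcc_left hx)
  rw [dist_add_left, dist_eq_norm, dist_eq_norm,
    intervalIntegral.integral_interval_sub_left (hx _ h1.1) (hx _ h1.2),
    intervalIntegral.integral_interval_sub_left (hx _ h1.1).norm (hx _ h1.2).norm]
  exact intervalIntegral.norm_integral_le_abs_integral_norm

/-- The difference of v and the primitive of w is absolutely continuous with derivative zero almost
everywhere, hence constant. -/
theorem AbsolutelyContinuousOnInterval.eq_add_integral {a b : ℝ} (hab : a < b) {v w : ℝ → ℂ}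
    (hv : AbsolutelyContinuousOnInterval v a b) (hw : IntegrableOn w (Ioc a b))
    (h : w =ᵐ[volume.restrict (Icc a b)] derivWithin v (Icc a b)) {t : ℝ} (ht : t ∈ Icc a b) :
    v t = v a + ∫ τ in a..t, w τ := by
  have hi := intervalIntegrable_of_integrableOn_Ioc hw (right_mem_Icc.2 hab.le)
  have hac : AbsolutelyContinuousOnInterval (fun t => v t - (0 + ∫ τ in a..t, w τ)) a b :=
    hv.sub (absolutelyContinuousOnInterval_primitive hab.le hw 0)
  have hbv := hv.boundedVariationOn.locallyBoundedVariationOn.ae_differentiableWithinAt_of_mem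
  have hae : ∀ᵐ x, x ∈ uIcc a b →
      HasDerivAt (fun t => v t - (0 + ∫ τ in a..t, w τ)) 0 x := by
    -- The endpoints are discarded because the derivative within [a,b] is a two-sided derivative
    -- only in the interior.
    have hne : ∀ c : ℝ, ∀ᵐ x, x ≠ c := fun c => by simp [ae_iff, measure_singleton]
    rw [EventuallyEq, ae_restrict_iff' measurableSet_Icc] at h
    filter_upwards [hbv, hi.ae_hasDerivAt_integral, h, hne a, hne b] with x h1 h2 h3 h4 h5 hx
    have hx' := hx
    rw [uIcc_of_le hab.le] at hx' h1
    have hnhds : Icc a b ∈ 𝓝 x :=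
      Icc_mem_nhds (lt_of_le_of_ne hx'.1 h4.symm) (lt_of_le_of_ne hx'.2 h5)
    have h6 := (h1 hx').hasDerivWithinAt.hasDerivAt hnhds
    rw [← h3 hx'] at h6
    have h7 := h6.sub ((h2 hx a left_mem_uIcc).const_add 0)
    rwa [sub_self] at h7
  obtain ⟨C, hC⟩ := hac.const_of_ae_hasDerivAt_zero hae
  have h1 := hC a left_mem_uIcc
  have h2 := hC t (by rwa [uIcc_of_le hab.le])
  simp only [intervalIntegral.integral_same, add_zero, sub_zero, zero_add] at h1 h2
  rw [h1, ← h2]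
  ring

variable {a b : ℝ} {d : ℕ → ℂ} {w : ℝ → ℂ}

theorem integrableOn_iterPrim (hab : a ≤ b) (d : ℕ → ℂ) (hw : IntegrableOn w (Ioc a b)) (j : ℕ) :
    IntegrableOn (iterPrim a d w j) (Ioc a b) := by
  induction j with
  | zero => exact hw
  | succ j ih =>
    have := (absolutelyContinuousOnInterval_primitive hab ih (d (j + 1))).continuousOn
    rw [uIcc_of_le hab] at this
    exact this.integrableOn_Icc.mono_set Ioc_subset_Icc_self

theorem absolutelyContinuousOnInterval_iterPrim (hab : a ≤ b) (d : ℕ → ℂ)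
    (hw : IntegrableOn w (Ioc a b)) (j : ℕ) :
    AbsolutelyContinuousOnInterval (iterPrim a d w (j + 1)) a b :=
  absolutelyContinuousOnInterval_primitive hab (integrableOn_iterPrim hab d hw j) _

theorem continuousOn_iterPrim (hab : a ≤ b) (d : ℕ → ℂ)
    (hw : IntegrableOn w (Ioc a b)) (j : ℕ) :
    ContinuousOn (iterPrim a d w (j + 1)) (Icc a b) := by
  rw [← uIcc_of_le hab]
  exact (absolutelyContinuousOnInterval_iterPrim hab d hw j).continuousOn

/-- From the second primitive on the integrand is continuous, so the derivative exists at every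
point; the first primitive is differentiable only almost everywhere. -/
theorem hasDerivWithinAt_iterPrim (hab : a ≤ b) (d : ℕ → ℂ) (hw : IntegrableOn w (Ioc a b))
    (j : ℕ) {t : ℝ} (ht : t ∈ Icc a b) :
    HasDerivWithinAt (iterPrim a d w (j + 2)) (iterPrim a d w (j + 1) t) (Icc a b) t := by
  have hc := continuousOn_iterPrim hab d hw j
  have : Fact (t ∈ Icc a b) := ⟨ht⟩
  refine (intervalIntegral.integral_hasDerivWithinAt_right (s := Icc a b) (t := Icc a b)
    (intervalIntegrable_of_integrableOn_Ioc (integrableOn_iterPrim hab d hw (j + 1)) ht)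
    ?_ (hc t ht)).const_add _
  exact hc.stronglyMeasurableAtFilter_nhdsWithin measurableSet_Icc t

theorem iteratedDerivWithin_iterPrim (hab : a < b) (d : ℕ → ℂ) (hw : IntegrableOn w (Ioc a b))
    (i j : ℕ) :
    EqOn (iteratedDerivWithin i (iterPrim a d w (j + i + 1)) (Icc a b)) (iterPrim a d w (j + 1))
      (Icc a b) := by
  induction i with
  | zero => intro t _; simp
  | succ i ih =>
    rw [iteratedDerivWithin_succ']
    refine (iteratedDerivWithin_congr fun t ht => ?_).trans ih
    exact (hasDerivWithinAt_iterPrim hab.le d hw (j + i) ht).derivWithin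
      (uniqueDiffOn_Icc hab t ht)

theorem memACSucc_iterPrim (hab : a < b) (d : ℕ → ℂ) (hw : IntegrableOn w (Ioc a b)) (l : ℕ) :
    MemACSucc a b l (iterPrim a d w (l + 1)) := by
  have hi : ∀ m ≤ l, EqOn (iteratedDerivWithin m (iterPrim a d w (l + 1)) (Icc a b))
      (iterPrim a d w (l - m + 1)) (Icc a b) := fun m hm => by
    have := iteratedDerivWithin_iterPrim hab d hw m (l - m)
    rwa [Nat.sub_add_cancel hm] at this
  refine ⟨?_, ?_⟩
  · rw [contDiffOn_nat_iff_continuousOn_differentiableOn_deriv (uniqueDiffOn_Icc hab)]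
    refine ⟨fun m hm => (continuousOn_iterPrim hab.le d hw _).congr (hi m hm),
      fun m hm => DifferentiableOn.congr (fun t ht => ?_) (hi m hm.le)⟩
    obtain ⟨k, hk⟩ := Nat.exists_eq_add_of_lt hm
    rw [show l - m + 1 = k + 2 by omega]
    exact (hasDerivWithinAt_iterPrim hab.le d hw k ht).differentiableWithinAt
  · have h := hi l le_rfl
    rw [Nat.sub_self] at h
    refine (absolutelyContinuousOnInterval_iterPrim hab.le d hw 0).congr' ?_
    rw [EventuallyEq, eventually_inf_principal]
    refine Eventually.of_forall fun E hE => Finset.sum_congr rfl fun i hi' => ?_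
    have := hE.1 i hi'
    rw [uIcc_of_le hab.le] at this
    rw [h this.1, h this.2]

theorem ae_eq_iteratedDerivWithin_iterPrim (hab : a < b) (d : ℕ → ℂ)
    (hw : IntegrableOn w (Ioc a b)) (l : ℕ) :
    w =ᵐ[volume.restrict (Icc a b)]
      iteratedDerivWithin (l + 1) (iterPrim a d w (l + 1)) (Icc a b) := by
  have hi := intervalIntegrable_of_integrableOn_Ioc hw (right_mem_Icc.2 hab.le)
  have h := iteratedDerivWithin_iterPrim hab d hw l 0
  rw [zero_add, zero_add] at h
  rw [EventuallyEq, ae_restrict_iff' measurableSet_Icc]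
  filter_upwards [hi.ae_hasDerivAt_integral] with x hx hxI
  rw [iteratedDerivWithin_succ, derivWithin_congr h (h hxI)]
  exact (((hx (by rwa [uIcc_of_le hab.le]) a left_mem_uIcc).const_add _).hasDerivWithinAt.derivWithin
    (uniqueDiffOn_Icc hab x hxI)).symm

theorem MemACSucc.mono (hab : a < b) {v : ℝ → ℂ} {j l : ℕ} (hv : MemACSucc a b l v)
    (hjl : j ≤ l) : MemACSucc a b j v := by
  rcases hjl.eq_or_lt with rfl | hlt
  · exact hv
  refine ⟨hv.1.of_le (by exact_mod_cast hjl), ContDiffOn.absolutelyContinuousOnInterval ?_⟩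
  rw [uIcc_of_le hab.le]
  exact ((contDiffOn_nat_succ_iff_contDiffOn_one_iteratedDerivWithin
    (uniqueDiffOn_Icc hab)).1 (hv.1.of_le (by exact_mod_cast hlt))).2

/-- The derivatives of v are recovered from the top down, each from the one above it and its value
at a. Here k + 1 counts the integrations, which matches the index of the initial value C_(k+1). -/
theorem MemACSucc.iteratedDerivWithin_eq_iterPrim (hab : a < b) {v : ℝ → ℂ} {l : ℕ}
    (hv : MemACSucc a b l v) (hw : IntegrableOn w (Ioc a b))
    (h : w =ᵐ[volume.restrict (Icc a b)] iteratedDerivWithin (l + 1) v (Icc a b))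
    (hd : ∀ k ≤ l, iteratedDerivWithin (l - k) v (Icc a b) a = d (k + 1)) {k : ℕ} (hk : k ≤ l) :
    EqOn (iteratedDerivWithin (l - k) v (Icc a b)) (iterPrim a d w (k + 1)) (Icc a b) := by
  induction k with
  | zero =>
    intro t ht
    rw [iteratedDerivWithin_succ] at h
    rw [Nat.sub_zero, hv.2.eq_add_integral hab hw h ht, iterPrim, iterPrim]
    rw [← hd 0 (Nat.zero_le _), Nat.sub_zero]
  | succ k ih =>
    intro t ht
    have ih := ih (Nat.le_of_succ_le hk)
    rw [(hv.mono hab (Nat.sub_le l (k + 1))).2.eq_add_integral hab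
      (integrableOn_iterPrim hab.le d hw (k + 1)) ?_ ht, hd _ hk, ← iterPrim_succ_apply]
    filter_upwards [ae_restrict_mem measurableSet_Icc] with x hx
    rw [← ih hx, ← iteratedDerivWithin_succ]
    congr 1
    omega

/-- Taylor's formula with integral remainder. One more integration raises every order by 1, and the
new constant enters as the last summand, whose kernel of order 1 is identically 1. -/
theorem iterPrim_ae_eq (d : ℕ → ℂ) (hw : IntegrableOn w (Ioc a b)) (j : ℕ) :
    iterPrim a d w (j + 1) =ᵐ[volume.restrict (Ioc a b)] fun t =>
      volterra a (rlKernel ((j : ℂ) + 1)) w t + initialPart a (j + 1) d ((j : ℂ) + 1) t := by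
  induction j with
  | zero =>
    refine Eventually.of_forall fun t => ?_
    simp [iterPrim, volterra_rlKernel_one, initialPart, rlKernel, add_comm]
  | succ j ih =>
    have hj : 0 < ((j : ℂ) + 1).re := by simp; positivity
    have hj' : (((j + 1 : ℕ) : ℝ)) - 1 < ((j : ℂ) + 1).re := by simp
    filter_upwards [volterra_add (integrableOn_rlKernel (ν := 1) (by simp) (b - a))
      (integrableOn_volterra (integrableOn_rlKernel hj _) hw)
      (integrableOn_initialPart (a := a) b d hj'),
      volterra_rlKernel_comp (μ := 1) (by simp) hj hw,
      volterra_rlKernel_initialPart (a := a) b d (μ := 1) (by simp) hj',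
      ae_restrict_mem measurableSet_Ioc] with t h1 h2 h3 ht
    rw [iterPrim_succ_apply, ← volterra_rlKernel_one, volterra_congr_right _ ih (Ioc_subset_Icc_self ht),
      h1, h2, h3, initialPart, initialPart, Finset.sum_range_succ _ (j + 1)]
    have e : (1 : ℂ) + (j + 1) = ((j + 1 : ℕ) : ℂ) + 1 := by push_cast; ring
    rw [e]
    simp [rlKernel]
    ring

end

/-! ### Termwise integration of power series and Gamma quotients -/

noncomputable section

theorem norm_cpow_sub_one {x : ℝ} (hx : 0 < x) (z : ℂ) :
    ‖(x : ℂ) ^ (z - 1)‖ = x ^ (z.re - 1) := by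
  rw [Complex.norm_cpow_eq_rpow_re_of_pos hx]
  simp

theorem continuousOn_cpow_sub_one (z : ℂ) :
    ContinuousOn (fun x : ℝ => (x : ℂ) ^ (z - 1)) (Ioi 0) := fun x hx =>
  (Complex.continuousAt_ofReal_cpow_const x (z - 1) (Or.inr (ne_of_gt hx))).continuousWithinAt

/-- A series `∑ d_j x^{z_j-1}` dominated by `(∑ M_j) x^{ρ-1}`, with `ρ > 0`, is integrable and can
be integrated termwise against a Riemann-Liouville kernel. -/
theorem integrableOn_of_hasSum_cpow {T ρ : ℝ} (hρ : 0 < ρ) {d z : ℕ → ℂ} {M : ℕ → ℝ}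
    (hM : Summable M)
    (hbound : ∀ j, ∀ x ∈ Ioc 0 T, ‖d j * (x : ℂ) ^ (z j - 1)‖ ≤ M j * x ^ (ρ - 1))
    {h : ℝ → ℂ} (hh : ∀ x ∈ Ioc 0 T, HasSum (fun j => d j * (x : ℂ) ^ (z j - 1)) (h x)) :
    IntegrableOn h (Ioc 0 T) := by
  have hmeas : AEStronglyMeasurable h (volume.restrict (Ioc 0 T)) := by
    refine aestronglyMeasurable_of_tendsto_ae atTop
      (f := fun n x => ∑ j ∈ Finset.range n, d j * ((x : ℝ) : ℂ) ^ (z j - 1)) (fun n => ?_) ?_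
    · refine ContinuousOn.aestronglyMeasurable (continuousOn_finsetSum _ fun j _ => ?_)
        measurableSet_Ioc
      exact continuousOn_const.mul ((continuousOn_cpow_sub_one _).mono fun x hx => hx.1)
    · filter_upwards [ae_restrict_mem measurableSet_Ioc] with x hx
      exact (hh x hx).tendsto_sum_nat
  have hint : IntegrableOn (fun x : ℝ => (∑' j, M j) * x ^ (ρ - 1)) (Ioc 0 T) := by
    refine Integrable.const_mul ?_ _
    refine (integrableOn_cpow_sub_one (z := (ρ : ℂ)) (by simpa) T).norm.congr ?_
    filter_upwards [ae_restrict_mem measurableSet_Ioc] with x hx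
    simpa using norm_cpow_sub_one hx.1 (ρ : ℂ)
  refine Integrable.mono' hint hmeas ?_
  filter_upwards [ae_restrict_mem measurableSet_Ioc] with x hx
  rw [← (hh x hx).tsum_eq, ← tsum_mul_right]
  exact tsum_of_norm_bounded (hM.mul_right _).hasSum fun j => hbound j x hx

/-- Dominated convergence: the partial sums are controlled by |x-s|^(Re ν - 1) s^(ρ-1), up to a
constant. -/
theorem hasSum_volterra_rlKernel {T ρ : ℝ} (hρ : 0 < ρ) {d z : ℕ → ℂ} {M : ℕ → ℝ}
    (hz : ∀ j, 0 < (z j).re) (hM : Summable M)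
    (hbound : ∀ j, ∀ x ∈ Ioc 0 T, ‖d j * (x : ℂ) ^ (z j - 1)‖ ≤ M j * x ^ (ρ - 1))
    {h : ℝ → ℂ} (hh : ∀ x ∈ Ioc 0 T, HasSum (fun j => d j * (x : ℂ) ^ (z j - 1)) (h x))
    {ν : ℂ} (hν : 0 < ν.re) {x : ℝ} (hx : x ∈ Ioc 0 T) :
    HasSum (fun j => d j * Complex.Gamma (z j) * rlKernel (ν + z j) x)
      (volterra 0 (rlKernel ν) h x) := by
  have hterm : ∀ j, d j * Complex.Gamma (z j) * rlKernel (ν + z j) x =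
      ∫ s in (0 : ℝ)..x, rlKernel ν (x - s) * (d j * (s : ℂ) ^ (z j - 1)) := fun j => by
    rw [mul_assoc, ← volterra_rlKernel_cpow hν (hz j) hx.1, ← volterra_const_mul, volterra]
  have hsub : uIoc 0 x ⊆ Ioc 0 T := by
    rw [uIoc_of_le hx.1.le]
    exact Ioc_subset_Ioc_right hx.2
  have hmeas : AEStronglyMeasurable (fun s => rlKernel ν (x - s)) (volume.restrict (uIoc 0 x)) := by
    have : Measurable (rlKernel ν) :=
      measurable_const.mul (Complex.measurable_ofReal.pow_const _)
    exact (this.comp (measurable_const.sub measurable_id)).aestronglyMeasurable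
  simp only [hterm, volterra]
  refine intervalIntegral.hasSum_integral_of_dominated_convergence
    (fun j s => M j * (‖rlKernel ν (x - s)‖ * s ^ (ρ - 1))) (fun j => ?_) (fun j => ?_) ?_ ?_ ?_
  · refine hmeas.mul (ContinuousOn.aestronglyMeasurable ?_ measurableSet_uIoc)
    exact continuousOn_const.mul ((continuousOn_cpow_sub_one _).mono fun s hs => (hsub hs).1)
  · refine Eventually.of_forall fun s hs => ?_
    rw [norm_mul]
    calc _ ≤ ‖rlKernel ν (x - s)‖ * (M j * s ^ (ρ - 1)) := by
          gcongr
          exact hbound j s (hsub hs)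
      _ = _ := by ring
  · exact Eventually.of_forall fun s hs => hM.mul_right _
  · simp only [tsum_mul_right]
    refine IntervalIntegrable.const_mul ?_ _
    -- After the substitution s ↦ s/x the majorant is, up to a constant, the norm of a Beta
    -- integrand with parameters ρ and ν.
    have hb := Complex.betaIntegral_convergent (u := (ρ : ℂ)) (v := ν) (by simpa) hν
    have hb := (hb.comp_mul_right (c := x⁻¹)).norm
    rw [intervalIntegrable_iff] at hb ⊢
    simp only [zero_div, one_div, inv_inv] at hb
    refine Integrable.congr (Integrable.const_mul hb (‖(Complex.Gamma ν)⁻¹‖ * x ^ (ρ - 1) * x ^ (ν.re - 1))) ?_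
    rw [uIoc_of_le hx.1.le, EventuallyEq, Measure.restrict_congr_set Ioo_ae_eq_Ioc.symm]
    filter_upwards [ae_restrict_mem measurableSet_Ioo] with s hs
    have h0 : 0 < s * x⁻¹ := mul_pos hs.1 (inv_pos.2 hx.1)
    have h1 : 0 < 1 - s * x⁻¹ := by
      rw [← div_eq_mul_inv, sub_pos, div_lt_one hx.1]; exact hs.2
    have e : (1 : ℂ) - ((s * x⁻¹ : ℝ) : ℂ) = ((1 - s * x⁻¹ : ℝ) : ℂ) := by push_cast; ring
    rw [norm_mul, e, norm_cpow_sub_one h0, norm_cpow_sub_one h1, rlKernel, norm_mul,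
      norm_cpow_sub_one (sub_pos.2 hs.2), Complex.ofReal_re]
    have e1 : x - s = x * (1 - s * x⁻¹) := by field_simp [hx.1.ne']
    have e2 : s ^ (ρ - 1) = x ^ (ρ - 1) * (s * x⁻¹) ^ (ρ - 1) := by
      rw [← Real.mul_rpow hx.1.le h0.le]
      congr 1
      field_simp [hx.1.ne']
    rw [e1, Real.mul_rpow hx.1.le h1.le, e2]
    ring
  · exact Eventually.of_forall fun s hs => (hh s (hsub hs)).mul_left _

theorem norm_betaIntegral_le {u v : ℂ} {ρ : ℝ} (hρ : 0 < ρ) (hu : ρ ≤ u.re) (hv : 1 ≤ v.re) :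
    ‖Complex.betaIntegral u v‖ ≤ 1 / ρ := by
  have hI : ∫ x in (0 : ℝ)..1, x ^ (ρ - 1) = 1 / ρ := by
    rw [integral_rpow (Or.inl (by linarith))]
    simp [hρ.ne']
  rw [← hI, Complex.betaIntegral]
  refine intervalIntegral.norm_integral_le_of_norm_le zero_le_one ?_
    (intervalIntegral.intervalIntegrable_rpow' (by linarith))
  have hne : ∀ᵐ x : ℝ, x ≠ 1 := by simp [ae_iff, measure_singleton]
  filter_upwards [hne] with x hx1 hx
  have h1 : 0 < 1 - x := sub_pos.2 (lt_of_le_of_ne hx.2 hx1)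
  have e : (1 : ℂ) - (x : ℂ) = ((1 - x : ℝ) : ℂ) := by push_cast; ring
  rw [norm_mul, e, norm_cpow_sub_one hx.1, norm_cpow_sub_one h1]
  calc _ ≤ x ^ (ρ - 1) * 1 := by
        refine mul_le_mul ?_ ?_ (Real.rpow_nonneg h1.le _) (Real.rpow_nonneg hx.1.le _)
        · exact Real.rpow_le_rpow_of_exponent_ge hx.1 hx.2 (by linarith)
        · exact Real.rpow_le_one h1.le (by linarith [hx.1]) (by linarith)
    _ = _ := mul_one _

/-- The quotient equals B(z,γ+1)(z+γ)/Γ(γ+1). Passing to γ + 1 keeps the Beta integral convergent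
and bounded even when Re γ = 0, at the cost of a factor linear in z. -/
theorem norm_Gamma_div_Gamma_add_le {z γ : ℂ} {ρ : ℝ} (hρ : 0 < ρ) (hz : ρ ≤ z.re)
    (hγ : 0 ≤ γ.re) :
    ‖Complex.Gamma z / Complex.Gamma (z + γ)‖ ≤
      ‖(Complex.Gamma (γ + 1))⁻¹‖ / ρ * ‖z + γ‖ := by
  have hz0 : 0 < z.re := hρ.trans_le hz
  have hzγ : 0 < (z + γ).re := by rw [Complex.add_re]; linarith
  have hγ1 : 0 < (γ + 1).re := by simp; linarith
  have h1 := Complex.Gamma_mul_Gamma_eq_betaIntegral hz0 hγ1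
  have hne : z + γ ≠ 0 := fun h => by simp [h] at hzγ
  rw [← add_assoc, Complex.Gamma_add_one _ hne] at h1
  have h2 := Complex.Gamma_ne_zero_of_re_pos hzγ
  have h3 := Complex.Gamma_ne_zero_of_re_pos hγ1
  have h4 : Complex.Gamma z / Complex.Gamma (z + γ) =
      (Complex.Gamma (γ + 1))⁻¹ * Complex.betaIntegral z (γ + 1) * (z + γ) := by
    field_simp
    linear_combination h1
  rw [h4, norm_mul, norm_mul]
  calc _ ≤ ‖(Complex.Gamma (γ + 1))⁻¹‖ * (1 / ρ) * ‖z + γ‖ := by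
        gcongr
        exact norm_betaIntegral_le hρ hz (by simp; linarith)
    _ = _ := by ring

/-- The factor n + 1 is there to absorb the linear growth of the Gamma quotients. Comparison with a
radius q strictly between r and R leaves a geometric factor (r/q)^n. -/
theorem summable_succ_mul_of_summable_ball {c : ℕ → ℂ} {r R : ℝ} (hr : 0 ≤ r) (hrR : r < R)
    (hc : ∀ x ∈ Metric.ball (0 : ℂ) R, Summable fun n : ℕ => c n * x ^ n) :
    Summable fun n : ℕ => ((n : ℝ) + 1) * (‖c n‖ * r ^ n) := by
  obtain ⟨q, hrq, hqR⟩ := exists_between hrR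
  have hq : 0 < q := hr.trans_lt hrq
  have hs := hc (q : ℂ) (by simpa [abs_of_pos hq] using hqR)
  obtain ⟨B, hB⟩ := (Metric.isBounded_range_of_tendsto _ hs.tendsto_atTop_zero).exists_norm_le
  have hlt : ‖r / q‖ < 1 := by
    rw [Real.norm_of_nonneg (by positivity), div_lt_one hq]; exact hrq
  have hsum : Summable fun n : ℕ => B * (((n : ℝ) + 1) * (r / q) ^ n) := by
    refine Summable.mul_left _ ?_
    have h1 := summable_pow_mul_geometric_of_norm_lt_one 1 hlt
    have h2 := summable_geometric_of_norm_lt_one hlt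
    refine (h1.add h2).congr fun n => ?_
    ring
  refine Summable.of_nonneg_of_le (fun n => by positivity) (fun n => ?_) hsum
  have h1 : ‖c n‖ * q ^ n ≤ B := by
    have := hB _ (mem_range_self n)
    simpa [abs_of_pos hq] using this
  calc ((n : ℝ) + 1) * (‖c n‖ * r ^ n) = ((n : ℝ) + 1) * (‖c n‖ * q ^ n * (r / q) ^ n) := by
        rw [div_pow]; field_simp
    _ ≤ ((n : ℝ) + 1) * (B * (r / q) ^ n) := by gcongr
    _ = _ := by ring

end

/-! ### The kernel K with I^(m-γ) K = I^m k -/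

noncomputable section

theorem im_ofReal_cpow_eq_zero {x : ℝ} (hx : 0 ≤ x) {w : ℂ} (hw : w.im = 0) :
    ((x : ℂ) ^ w).im = 0 := by
  have : w = (w.re : ℂ) := Complex.ext rfl (by simpa using hw)
  rw [this, ← Complex.ofReal_cpow hx, Complex.ofReal_im]

theorem im_Gamma_eq_zero {w : ℂ} (hw : w.im = 0) : (Complex.Gamma w).im = 0 := by
  have : w = (w.re : ℂ) := Complex.ext rfl (by simpa using hw)
  rw [this, Complex.Gamma_ofReal, Complex.ofReal_im]

theorem im_mul_eq_zero {z w : ℂ} (hz : z.im = 0) (hw : w.im = 0) : (z * w).im = 0 := by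
  simp [Complex.mul_im, hz, hw]

theorem im_inv_eq_zero {z : ℂ} (hz : z.im = 0) : (z⁻¹).im = 0 := by
  simp [Complex.inv_im, hz]

theorem im_rlKernel_eq_zero {ν : ℂ} (hν : ν.im = 0) {x : ℝ} (hx : 0 ≤ x) :
    (rlKernel ν x).im = 0 :=
  im_mul_eq_zero (im_inv_eq_zero (im_Gamma_eq_zero hν)) (im_ofReal_cpow_eq_zero hx (by simpa))

/-- K plays the role of I^γ k, but is defined by its series so that Re γ = 0 needs no separate
treatment. Applying I^(m-γ) to K and I^m to k term by term gives the same series. -/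
theorem exists_kernel_of_hasSum {T : ℝ} (hT : 0 < T) {α β γ : ℂ} (hα : 0 < α.re)
    (hβ : 0 ≤ β.re) (hγ : 0 ≤ γ.re) {m : ℕ} (hm : γ.re < m) {c : ℕ → ℂ}
    (hc : Summable fun n : ℕ => ((n : ℝ) + 1) * (‖c n‖ * (T ^ β.re) ^ n)) {k : ℝ → ℂ}
    (hk : ∀ x ∈ Ioc 0 T, HasSum (fun n : ℕ => c n * (x : ℂ) ^ (α + β * n - 1)) (k x)) :
    IntegrableOn k (Ioc 0 T) ∧ ∃ K : ℝ → ℂ, IntegrableOn K (Ioc 0 T) ∧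
      (volterra 0 (rlKernel (m - γ)) K =ᵐ[volume.restrict (Ioc 0 T)]
        volterra 0 (rlKernel m) k) ∧
      (α.im = 0 → β.im = 0 → γ.im = 0 → (∀ n, (c n).im = 0) →
        ∀ x ∈ Ioc 0 T, (K x).im = 0) := by
  have hr : 0 ≤ T ^ β.re := Real.rpow_nonneg hT.le _
  have hzre : ∀ n : ℕ, (α + β * n).re = α.re + β.re * n := fun n => by simp
  have hzα : ∀ n : ℕ, α.re ≤ (α + β * n).re := fun n => by
    rw [hzre]
    have := mul_nonneg hβ (Nat.cast_nonneg (α := ℝ) n)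
    linarith
  have hz : ∀ n : ℕ, 0 < (α + β * n).re := fun n => hα.trans_le (hzα n)
  have hpow : ∀ n : ℕ, ∀ x ∈ Ioc 0 T, ‖(x : ℂ) ^ (α + β * n - 1)‖ ≤
      (T ^ β.re) ^ n * x ^ (α.re - 1) := fun n x hx => by
    rw [norm_cpow_sub_one hx.1, hzre, show α.re + β.re * n - 1 = β.re * n + (α.re - 1) by ring,
      Real.rpow_add hx.1, Real.rpow_mul hx.1.le, Real.rpow_natCast]
    have h1 := Real.rpow_nonneg hx.1.le (α.re - 1)
    have h2 := Real.rpow_nonneg hx.1.le β.re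
    gcongr
    · exact hx.1.le
    · exact hx.2
  have hM : Summable fun n : ℕ => ‖c n‖ * (T ^ β.re) ^ n :=
    Summable.of_nonneg_of_le (fun n => by positivity) (fun n => by
      have h0 : 0 ≤ ‖c n‖ * (T ^ β.re) ^ n := by positivity
      nlinarith [Nat.cast_nonneg (α := ℝ) n]) hc
  have hkb : ∀ n : ℕ, ∀ x ∈ Ioc 0 T, ‖c n * (x : ℂ) ^ (α + β * n - 1)‖ ≤
      ‖c n‖ * (T ^ β.re) ^ n * x ^ (α.re - 1) := fun n x hx => by
    rw [norm_mul, mul_assoc]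
    exact mul_le_mul_of_nonneg_left (hpow n x hx) (norm_nonneg _)
  set G : ℕ → ℂ := fun n => Complex.Gamma (α + β * n) / Complex.Gamma (α + β * n + γ) with hG
  -- Product of the constants in the Gamma quotient bound, in |α+βn+γ| ≤ (|α|+|β|+|γ|)(n+1), and in
  -- x^(Re γ) ≤ T^(Re γ).
  set D : ℝ := ‖(Complex.Gamma (γ + 1))⁻¹‖ / α.re * (‖α‖ + ‖β‖ + ‖γ‖) * T ^ γ.re with hD
  have hM' : Summable fun n : ℕ => D * (((n : ℝ) + 1) * (‖c n‖ * (T ^ β.re) ^ n)) :=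
    hc.mul_left D
  have hKb : ∀ n : ℕ, ∀ x ∈ Ioc 0 T, ‖c n * G n * (x : ℂ) ^ (α + β * n + γ - 1)‖ ≤
      D * (((n : ℝ) + 1) * (‖c n‖ * (T ^ β.re) ^ n)) * x ^ (α.re - 1) := fun n x hx => by
    have h1 : ‖G n‖ ≤ ‖(Complex.Gamma (γ + 1))⁻¹‖ / α.re *
        ((‖α‖ + ‖β‖ + ‖γ‖) * ((n : ℝ) + 1)) := by
      refine (norm_Gamma_div_Gamma_add_le hα (hzα n) hγ).trans ?_
      gcongr
      refine (norm_add₃_le).trans ?_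
      rw [norm_mul, Complex.norm_natCast]
      have hn : (0 : ℝ) ≤ n := Nat.cast_nonneg n
      nlinarith [norm_nonneg α, norm_nonneg β, norm_nonneg γ, mul_nonneg hn (norm_nonneg α),
        mul_nonneg hn (norm_nonneg γ)]
    have h2 : ‖(x : ℂ) ^ (α + β * n + γ - 1)‖ ≤
        T ^ γ.re * ((T ^ β.re) ^ n * x ^ (α.re - 1)) := by
      rw [show α + β * n + γ - 1 = γ + (α + β * n - 1) by ring,
        Complex.cpow_add _ _ (by exact_mod_cast hx.1.ne'), norm_mul,
        Complex.norm_cpow_eq_rpow_re_of_pos hx.1]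
      have := Real.rpow_le_rpow hx.1.le hx.2 hγ
      exact mul_le_mul this (hpow n x hx) (norm_nonneg _) (Real.rpow_nonneg hT.le _)
    rw [norm_mul, norm_mul]
    calc _ ≤ ‖c n‖ * (‖(Complex.Gamma (γ + 1))⁻¹‖ / α.re *
        ((‖α‖ + ‖β‖ + ‖γ‖) * ((n : ℝ) + 1))) * (T ^ γ.re * ((T ^ β.re) ^ n * x ^ (α.re - 1))) := by
          gcongr
      _ = _ := by rw [hD]; ring
  have hKs : ∀ x ∈ Ioc 0 T, HasSum (fun n : ℕ => c n * G n * (x : ℂ) ^ (α + β * n + γ - 1))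
      (∑' n : ℕ, c n * G n * (x : ℂ) ^ (α + β * n + γ - 1)) := fun x hx =>
    (Summable.of_norm_bounded (hM'.mul_right _) fun n => hKb n x hx).hasSum
  refine ⟨integrableOn_of_hasSum_cpow hα hM hkb hk, _,
    integrableOn_of_hasSum_cpow hα hM' hKb hKs, ?_, ?_⟩
  · filter_upwards [ae_restrict_mem measurableSet_Ioc] with x hx
    have hzγ : ∀ n : ℕ, 0 < (α + β * n + γ).re := fun n => by
      rw [Complex.add_re]; linarith [hz n]
    have s1 := hasSum_volterra_rlKernel hα hz hM hkb hk (ν := (m : ℂ))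
      (by simpa using hγ.trans_lt hm) hx
    have s2 := hasSum_volterra_rlKernel hα hzγ hM' hKb hKs (ν := (m : ℂ) - γ)
      (by simpa using hm) hx
    refine s2.unique ?_
    convert s1 using 2 with n
    have := Complex.Gamma_ne_zero_of_re_pos (hzγ n)
    rw [show (m : ℂ) - γ + (α + β * n + γ) = m + (α + β * n) by ring, hG]
    field_simp
  · intro h1 h2 h3 h4 x hx
    have hz : ∀ n : ℕ, (α + β * n).im = 0 := fun n => by simp [h1, h2]
    rw [Complex.im_tsum (hKs x hx).summable]
    convert tsum_zero with n
    refine im_mul_eq_zero (im_mul_eq_zero (h4 n) (im_mul_eq_zero (im_Gamma_eq_zero (hz n))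
      (im_inv_eq_zero (im_Gamma_eq_zero ?_)))) (im_ofReal_cpow_eq_zero hx.1.le ?_)
    · rw [Complex.add_im, hz, h3, add_zero]
    · rw [Complex.sub_im, Complex.add_im, hz, h3, Complex.one_im]; simp

theorem genKernel_hasSum {T : ℝ} {α β : ℂ} (hβ : 0 ≤ β.re) {R : ℝ} (hR : T ^ β.re < R)
    {A : ℂ → ℂ} {c : ℕ → ℂ}
    (hA : ∀ x ∈ Metric.ball (0 : ℂ) R, HasSum (fun n : ℕ => c n * x ^ n) (A x)) :
    ∀ x ∈ Ioc 0 T, HasSum (fun n : ℕ => c n * (x : ℂ) ^ (α + β * n - 1)) (genKernel A α β x) := by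
  intro x hx
  have hx0 : (x : ℂ) ≠ 0 := by exact_mod_cast hx.1.ne'
  have hmem : (x : ℂ) ^ β ∈ Metric.ball (0 : ℂ) R := by
    rw [mem_ball_zero_iff, Complex.norm_cpow_eq_rpow_re_of_pos hx.1]
    exact (Real.rpow_le_rpow hx.1.le hx.2 hβ).trans_lt hR
  have h := (hA _ hmem).mul_left ((x : ℂ) ^ (α - 1))
  have e : (fun n : ℕ => c n * (x : ℂ) ^ (α + β * n - 1)) =
      fun n : ℕ => (x : ℂ) ^ (α - 1) * (c n * ((x : ℂ) ^ β) ^ n) := by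
    ext n
    rw [show α + β * n - 1 = (α - 1) + β * n by ring, Complex.cpow_add _ _ hx0,
      Complex.cpow_mul_nat]
    ring
  rw [e]
  exact h

theorem summable_succ_mul_shift {c : ℕ → ℂ} {r : ℝ} (hr : 0 < r)
    (hc : Summable fun n : ℕ => ((n : ℝ) + 1) * (‖c n‖ * r ^ n)) :
    Summable fun n : ℕ => ((n : ℝ) + 1) * (‖c (n + 1)‖ * r ^ n) := by
  have h := ((summable_nat_add_iff 1).2 hc).mul_left r⁻¹
  refine Summable.of_nonneg_of_le (fun n => by positivity) (fun n => ?_) h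
  have e : r⁻¹ * ((((n + 1 : ℕ) : ℝ) + 1) * (‖c (n + 1)‖ * r ^ (n + 1))) =
      ((n : ℝ) + 2) * (‖c (n + 1)‖ * r ^ n) := by
    push_cast
    field_simp
    ring
  rw [e]
  gcongr
  norm_num

/-- Removing the leading term of the series replaces α by α + β. -/
theorem hasSum_cpow_shift {α β : ℂ} {c : ℕ → ℂ} {x : ℝ} {y : ℂ}
    (h : HasSum (fun n : ℕ => c n * (x : ℂ) ^ (α + β * n - 1)) y) :
    HasSum (fun n : ℕ => c (n + 1) * (x : ℂ) ^ (α + β + β * n - 1))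
      (y - c 0 * (x : ℂ) ^ (α - 1)) := by
  have h1 := (hasSum_nat_add_iff' 1).2 h
  simp only [Finset.range_one, Finset.sum_singleton, Nat.cast_zero, mul_zero, add_zero] at h1
  have e : (fun n : ℕ => c (n + 1) * (x : ℂ) ^ (α + β + β * n - 1)) =
      fun n : ℕ => c (n + 1) * (x : ℂ) ^ (α + β * ((n + 1 : ℕ) : ℂ) - 1) := by
    ext n
    congr 2
    push_cast
    ring
  rw [e]
  exact h1

theorem not_integrableOn_cpow_sub_one {T : ℝ} (hT : 0 < T) {α : ℂ} (hα : α.re = 0) :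
    ¬ IntegrableOn (fun x : ℝ => (x : ℂ) ^ (α - 1)) (Ioc 0 T) := fun h => by
  have h1 : IntegrableOn (fun x : ℝ => x⁻¹) (Ioc 0 T) := by
    refine h.norm.congr ?_
    filter_upwards [ae_restrict_mem measurableSet_Ioc] with x hx
    rw [norm_cpow_sub_one hx.1, hα, zero_sub, Real.rpow_neg_one]
  rw [← intervalIntegrable_iff_integrableOn_Ioc_of_le hT.le, intervalIntegrable_inv_iff] at h1
  rcases h1 with h1 | h1
  · exact hT.ne h1
  · exact h1 left_mem_uIcc

/-- Without its leading term the series is integrable, its exponent now being α + β. So c_0 x^(α-1)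
is integrable too, although |x^(α-1)| = 1/x. -/
theorem coeff_zero_eq_zero_of_integrableOn {T : ℝ} (hT : 0 < T) {α β : ℂ} (hα : α.re = 0)
    (hβ : 0 < β.re) {c : ℕ → ℂ}
    (hc : Summable fun n : ℕ => ((n : ℝ) + 1) * (‖c n‖ * (T ^ β.re) ^ n)) {k : ℝ → ℂ}
    (hk : ∀ x ∈ Ioc 0 T, HasSum (fun n : ℕ => c n * (x : ℂ) ^ (α + β * n - 1)) (k x))
    (hint : IntegrableOn k (Ioc 0 T)) : c 0 = 0 := by
  by_contra h0
  -- Only the integrability of the series is used, so γ = 0 and m = 1 are arbitrary admissible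
  -- choices.
  have h1 := (exists_kernel_of_hasSum hT (α := α + β) (β := β) (γ := 0) (m := 1)
    (by simpa [hα] using hβ) hβ.le (by simp) (by simp)
    (summable_succ_mul_shift (Real.rpow_pos_of_pos hT _) hc)
    fun x hx => hasSum_cpow_shift (hk x hx)).1
  refine not_integrableOn_cpow_sub_one hT hα (((hint.sub h1).const_mul (c 0)⁻¹).congr ?_)
  refine Eventually.of_forall fun x => ?_
  simp [h0]

/-- For β = is with s ≠ 0, log q = -2π/|s| makes β log q equal to ±2πi. -/
theorem exists_cpow_eq_one {β : ℂ} (hβ : β.re = 0) : ∃ q : ℝ, 0 < q ∧ q < 1 ∧ (q : ℂ) ^ β = 1 := by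
  by_cases hs : β.im = 0
  · refine ⟨1 / 2, by norm_num, by norm_num, ?_⟩
    rw [show β = 0 from Complex.ext hβ hs, Complex.cpow_zero]
  · have hpos : 0 < 2 * Real.pi / |β.im| := by positivity
    refine ⟨Real.exp (-(2 * Real.pi / |β.im|)), Real.exp_pos _, by simpa using hpos, ?_⟩
    rw [Complex.cpow_def_of_ne_zero (by exact_mod_cast (Real.exp_pos _).ne'),
      ← Complex.ofReal_log (Real.exp_pos _).le, Real.log_exp, Complex.exp_eq_one_iff]
    have hb : β = (β.im : ℂ) * Complex.I := by
      apply Complex.ext <;> simp [hβ]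
    rcases lt_or_gt_of_ne hs with h | h
    · refine ⟨1, ?_⟩
      rw [abs_of_neg h]
      nth_rw 2 [hb]
      have : (β.im : ℂ) ≠ 0 := by exact_mod_cast hs
      push_cast
      field_simp
    · refine ⟨-1, ?_⟩
      rw [abs_of_pos h]
      nth_rw 2 [hb]
      have : (β.im : ℂ) ≠ 0 := by exact_mod_cast hs
      push_cast
      field_simp

/-- Scaling gives the same integral over (0, q^j T] for every j, while these integrals tend to 0. -/
theorem ae_eq_zero_of_scale_invariant {T q : ℝ} (hT : 0 < T) (hq0 : 0 < q) (hq1 : q < 1)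
    {g : ℝ → ℝ} (hg : IntegrableOn g (Ioc 0 T)) (hg0 : ∀ x, 0 ≤ g x)
    (hscale : ∀ x, 0 < x → q * g (q * x) = g x) :
    g =ᵐ[volume.restrict (Ioc 0 T)] 0 := by
  have hstep : ∀ S : ℝ, 0 < S → ∫ x in (0 : ℝ)..(q * S), g x = ∫ x in (0 : ℝ)..S, g x := by
    intro S hS
    have h1 := intervalIntegral.mul_integral_comp_mul_left (a := 0) (b := S) (f := g) q
    rw [mul_zero] at h1
    rw [← h1, ← intervalIntegral.integral_const_mul, intervalIntegral.integral_of_le hS.le,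
      intervalIntegral.integral_of_le hS.le]
    exact setIntegral_congr_fun measurableSet_Ioc fun x hx => hscale x hx.1
  have hpow : ∀ j : ℕ, ∫ x in (0 : ℝ)..(q ^ j * T), g x = ∫ x in (0 : ℝ)..T, g x := by
    intro j
    induction j with
    | zero => simp
    | succ j ih => rw [pow_succ', mul_assoc, hstep _ (by positivity), ih]
  have hi : IntervalIntegrable g volume 0 T :=
    (intervalIntegrable_iff_integrableOn_Ioc_of_le hT.le).2 hg
  have hc := intervalIntegral.continuousOn_primitive_interval' hi left_mem_uIcc 0 left_mem_uIcc
  have hseq : Tendsto (fun j : ℕ => q ^ j * T) atTop (𝓝[uIcc 0 T] 0) := by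
    refine tendsto_nhdsWithin_iff.2 ⟨?_, Eventually.of_forall fun j => ?_⟩
    · simpa using (tendsto_pow_atTop_nhds_zero_of_lt_one hq0.le hq1).mul_const T
    · rw [uIcc_of_le hT.le]
      exact ⟨by positivity, mul_le_of_le_one_left hT.le (pow_le_one₀ hq0.le hq1.le)⟩
  have hlim := hc.tendsto.comp hseq
  have h0 : ∫ x in (0 : ℝ)..T, g x = 0 := by
    refine tendsto_nhds_unique ?_ (by simpa using hlim)
    refine tendsto_const_nhds.congr fun j => ?_
    exact (hpow j).symm
  rw [intervalIntegral.integral_of_le hT.le] at h0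
  exact (setIntegral_eq_zero_iff_of_nonneg_ae (Eventually.of_forall hg0) hg).1 h0

/-- With q^β = 1 the factor A(x^β) is unchanged under x ↦ qx, and |x^(α-1)| = 1/x, so the norm of
the kernel is scale invariant. -/
theorem genKernel_ae_eq_zero {T : ℝ} (hT : 0 < T) {α β : ℂ} (hα : α.re = 0)
    (hβ : β.re = 0) {A : ℂ → ℂ} (hint : IntegrableOn (genKernel A α β) (Ioc 0 T)) :
    genKernel A α β =ᵐ[volume.restrict (Ioc 0 T)] 0 := by
  obtain ⟨q, hq0, hq1, hq⟩ := exists_cpow_eq_one hβ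
  have := ae_eq_zero_of_scale_invariant hT hq0 hq1 hint.norm (fun x => norm_nonneg _)
    fun x hx => by
      rw [genKernel, genKernel, norm_mul, norm_mul, norm_cpow_sub_one (mul_pos hq0 hx),
        norm_cpow_sub_one hx, hα, zero_sub, Real.rpow_neg_one, Real.rpow_neg_one,
        Complex.ofReal_mul, Complex.mul_cpow_ofReal_nonneg hq0.le hx.le, hq, one_mul]
      field_simp
  filter_upwards [this] with x hx
  exact norm_eq_zero.1 hx

theorem exists_kernel {T : ℝ} (hT : 0 < T) {α β γ : ℂ} (hα : 0 ≤ α.re) (hβ : 0 ≤ β.re)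
    (hγ : 0 ≤ γ.re) {m : ℕ} (hm : γ.re < m) {R : ℝ} (hR : T ^ β.re < R) {A : ℂ → ℂ} {c : ℕ → ℂ}
    (hA : ∀ x ∈ Metric.ball (0 : ℂ) R, HasSum (fun n : ℕ => c n * x ^ n) (A x))
    (hker : 0 < α.re ∨ IntegrableOn (genKernel A α β) (Ioo 0 T)) :
    IntegrableOn (genKernel A α β) (Ioc 0 T) ∧ ∃ K : ℝ → ℂ, IntegrableOn K (Ioc 0 T) ∧
      (volterra 0 (rlKernel (m - γ)) K =ᵐ[volume.restrict (Ioc 0 T)]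
        volterra 0 (rlKernel m) (genKernel A α β)) ∧
      (α.im = 0 → β.im = 0 → γ.im = 0 → (∀ n, (c n).im = 0) →
        ∀ x ∈ Ioc 0 T, (K x).im = 0) := by
  have hc := summable_succ_mul_of_summable_ball (Real.rpow_nonneg hT.le β.re) hR
    fun x hx => (hA x hx).summable
  have hk := genKernel_hasSum (α := α) hβ hR hA
  rcases hα.lt_or_eq with hα' | hα'
  · exact exists_kernel_of_hasSum hT hα' hβ hγ hm hc hk
  have hint : IntegrableOn (genKernel A α β) (Ioc 0 T) := by
    rw [integrableOn_Ioc_iff_integrableOn_Ioo]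
    exact hker.resolve_left hα'.not_lt
  rcases hβ.lt_or_eq with hβ' | hβ'
  · have h0 := coeff_zero_eq_zero_of_integrableOn hT hα'.symm hβ' hc hk hint
    obtain ⟨h1, K, hK, hKe, hKr⟩ := exists_kernel_of_hasSum hT (α := α + β) (β := β)
      (by simpa [← hα'] using hβ') hβ hγ hm
      (summable_succ_mul_shift (Real.rpow_pos_of_pos hT _) hc)
      (k := genKernel A α β) fun x hx => by
        simpa [h0] using hasSum_cpow_shift (hk x hx)
    refine ⟨h1, K, hK, hKe, fun e1 e2 e3 e4 => hKr (by simp [e1, e2]) e2 e3 fun n => e4 _⟩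
  · refine ⟨hint, 0, integrableOn_zero, ?_, by simp⟩
    have h0 := genKernel_ae_eq_zero hT hα'.symm hβ'.symm hint
    filter_upwards [ae_restrict_mem measurableSet_Ioc] with x hx
    rw [volterra_congr_right _ h0 (Ioc_subset_Icc_self hx)]
    simp [volterra]

end

/-! ### Nonlinear Volterra equations of the second kind in L^1 -/

noncomputable section

variable {a b : ℝ} {K φ : ℝ → ℂ} {f : ℝ → ℂ → ℂ} {L : ℝ}

theorem integral_norm_volterra_sub_le (hK : IntegrableOn K (Ioc 0 (b - a)))
    (hf : ∀ u : ℝ → ℂ, IntegrableOn u (Ioc a b) → IntegrableOn (fun t => f t (u t)) (Ioc a b))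
    (hL : ∀ t ∈ Ioc a b, ∀ y₁ y₂ : ℂ, ‖f t y₁ - f t y₂‖ ≤ L * ‖y₁ - y₂‖)
    {u v : ℝ → ℂ} (hu : IntegrableOn u (Ioc a b)) (hv : IntegrableOn v (Ioc a b)) :
    ∫ t in Ioc a b, ‖volterra a K (fun t => f t (u t)) t - volterra a K (fun t => f t (v t)) t‖ ≤
      ((∫ x in Ioc 0 (b - a), ‖K x‖) * L) * ∫ t in Ioc a b, ‖u t - v t‖ := by
  have e : ∫ t in Ioc a b,
      ‖volterra a K (fun t => f t (u t)) t - volterra a K (fun t => f t (v t)) t‖ =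
      ∫ t in Ioc a b, ‖volterra a K (fun t => f t (u t) - f t (v t)) t‖ := by
    refine integral_congr_ae ?_
    filter_upwards [volterra_sub hK (hf u hu) (hf v hv)] with t ht
    rw [ht]
  rw [e, mul_assoc]
  refine (integral_norm_volterra_le hK ((hf u hu).sub (hf v hv))).trans ?_
  refine mul_le_mul_of_nonneg_left ?_ (integral_nonneg fun _ => norm_nonneg _)
  rw [← integral_const_mul]
  exact setIntegral_mono_on ((hf u hu).sub (hf v hv)).norm ((hu.sub hv).norm.const_mul L)
    measurableSet_Ioc fun t ht => hL t ht _ _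

/-- Banach's fixed point theorem in L^1: by Young's inequality the right-hand side is Lipschitz with
constant ‖K‖₁ L < 1. The same estimate gives uniqueness among representatives. -/
theorem exists_volterra_solution_of_small (hK : IntegrableOn K (Ioc 0 (b - a)))
    (hφ : IntegrableOn φ (Ioc a b))
    (hf : ∀ u : ℝ → ℂ, IntegrableOn u (Ioc a b) → IntegrableOn (fun t => f t (u t)) (Ioc a b))
    (hL : ∀ t ∈ Ioc a b, ∀ y₁ y₂ : ℂ, ‖f t y₁ - f t y₂‖ ≤ L * ‖y₁ - y₂‖) (hL0 : 0 ≤ L)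
    (hsmall : (∫ x in Ioc 0 (b - a), ‖K x‖) * L < 1) :
    ∃ u : ℝ → ℂ, IntegrableOn u (Ioc a b) ∧
      (u =ᵐ[volume.restrict (Ioc a b)] fun t => φ t + volterra a K (fun t => f t (u t)) t) ∧
      ∀ v : ℝ → ℂ, IntegrableOn v (Ioc a b) →
        (v =ᵐ[volume.restrict (Ioc a b)] fun t => φ t + volterra a K (fun t => f t (v t)) t) →
        v =ᵐ[volume.restrict (Ioc a b)] u := by
  have hΨ : ∀ u : ℝ → ℂ, IntegrableOn u (Ioc a b) →
      Integrable (fun t => φ t + volterra a K (fun t => f t (u t)) t)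
        (volume.restrict (Ioc a b)) := fun u hu =>
    hφ.add (integrableOn_volterra hK (hf u hu))
  have hest : ∀ u v : ℝ → ℂ, IntegrableOn u (Ioc a b) → IntegrableOn v (Ioc a b) →
      ∫ t in Ioc a b, ‖(φ t + volterra a K (fun t => f t (u t)) t) -
        (φ t + volterra a K (fun t => f t (v t)) t)‖ ≤
      ((∫ x in Ioc 0 (b - a), ‖K x‖) * L) * ∫ t in Ioc a b, ‖u t - v t‖ := fun u v hu hv => by
    simp only [add_sub_add_left_eq_sub]
    exact integral_norm_volterra_sub_le hK hf hL hu hv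
  let Φ : (ℝ →₁[volume.restrict (Ioc a b)] ℂ) → (ℝ →₁[volume.restrict (Ioc a b)] ℂ) :=
    fun u => (hΨ u (L1.integrable_coeFn u)).toL1 _
  set q := (∫ x in Ioc 0 (b - a), ‖K x‖) * L with hq
  have hq0 : 0 ≤ q := mul_nonneg (integral_nonneg fun _ => norm_nonneg _) hL0
  have hdist : ∀ u v : ℝ →₁[volume.restrict (Ioc a b)] ℂ,
      dist u v = ∫ t in Ioc a b, ‖u t - v t‖ := fun u v => by
    rw [dist_eq_norm, L1.norm_eq_integral_norm]
    refine integral_congr_ae ?_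
    filter_upwards [Lp.coeFn_sub u v] with t ht
    rw [ht, Pi.sub_apply]
  have hΦ : ContractingWith ⟨q, hq0⟩ Φ := by
    refine ⟨hsmall, LipschitzWith.of_dist_le_mul fun u v => ?_⟩
    rw [hdist, hdist]
    refine le_trans (le_of_eq ?_)
      (hest u v (L1.integrable_coeFn u) (L1.integrable_coeFn v))
    refine integral_congr_ae ?_
    filter_upwards [(hΨ u (L1.integrable_coeFn u)).coeFn_toL1,
      (hΨ v (L1.integrable_coeFn v)).coeFn_toL1] with t h1 h2
    rw [h1, h2]
  let w := hΦ.fixedPoint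
  have hw : Φ w = w := hΦ.fixedPoint_isFixedPt
  have hwi : IntegrableOn w (Ioc a b) := L1.integrable_coeFn w
  have hweq : w =ᵐ[volume.restrict (Ioc a b)]
      fun t => φ t + volterra a K (fun t => f t (w t)) t := by
    have := (hΨ w hwi).coeFn_toL1
    change ⇑(Φ w) =ᵐ[_] _ at this
    rwa [hw] at this
  refine ⟨w, hwi, hweq, fun v hv hveq => ?_⟩
  have h1 := hest v w hv hwi
  have h2 : ∫ t in Ioc a b, ‖v t - w t‖ = ∫ t in Ioc a b,
      ‖(φ t + volterra a K (fun t => f t (v t)) t) -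
        (φ t + volterra a K (fun t => f t (w t)) t)‖ := by
    refine integral_congr_ae ?_
    filter_upwards [hveq, hweq] with t h3 h4
    rw [h3, h4]
  rw [← h2] at h1
  have h3 : 0 ≤ ∫ t in Ioc a b, ‖v t - w t‖ := integral_nonneg fun _ => norm_nonneg _
  have h4 : ∫ t in Ioc a b, ‖v t - w t‖ = 0 := by nlinarith
  have h5 := (integral_eq_zero_iff_of_nonneg (fun t => norm_nonneg (v t - w t))
    (hv.sub hwi).norm).1 h4
  filter_upwards [h5] with t ht
  exact sub_eq_zero.1 (norm_eq_zero.1 ht)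

/-- The weighted kernels tend to 0 for x > 0 and are dominated by ‖K‖. -/
theorem exists_exp_weight_small (hK : IntegrableOn K (Ioc 0 (b - a))) (L : ℝ) :
    ∃ n : ℕ, (∫ x in Ioc 0 (b - a), ‖(Real.exp (-n * x) : ℂ) * K x‖) * L < 1 := by
  have h : Tendsto (fun n : ℕ => ∫ x in Ioc 0 (b - a), ‖(Real.exp (-n * x) : ℂ) * K x‖) atTop
      (𝓝 (∫ x in Ioc 0 (b - a), (0 : ℝ))) := by
    refine tendsto_integral_of_dominated_convergence (fun x => ‖K x‖) (fun n => ?_) hK.norm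
      (fun n => ?_) ?_
    · exact ((by fun_prop : Continuous fun x : ℝ => (Real.exp (-n * x) : ℂ)).aestronglyMeasurable.mul
        hK.aestronglyMeasurable).norm
    · filter_upwards [ae_restrict_mem measurableSet_Ioc] with x hx
      rw [norm_norm, norm_mul, Complex.norm_real, Real.norm_of_nonneg (Real.exp_pos _).le]
      refine mul_le_of_le_one_left (norm_nonneg _) (Real.exp_le_one_iff.2 ?_)
      have := mul_nonneg (Nat.cast_nonneg (α := ℝ) n) hx.1.le
      linarith
    · filter_upwards [ae_restrict_mem measurableSet_Ioc] with x hx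
      have h1 : Tendsto (fun n : ℕ => Real.exp (-n * x)) atTop (𝓝 0) := by
        refine Real.tendsto_exp_atBot.comp ?_
        have := (tendsto_natCast_atTop_atTop (R := ℝ)).atTop_mul_const hx.1
        refine (tendsto_neg_atTop_atBot.comp this).congr fun n => ?_
        simp
      have h2 := h1.mul_const ‖K x‖
      rw [zero_mul] at h2
      refine h2.congr fun n => ?_
      rw [norm_mul, Complex.norm_real, Real.norm_of_nonneg (Real.exp_pos _).le]
  rw [integral_zero] at h
  have h := h.mul_const L
  rw [zero_mul] at h
  exact (h.eventually_lt_const one_pos).exists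

theorem integrableOn_exp_mul {g : ℝ → ℂ} (hg : IntegrableOn g (Ioc a b)) (r : ℝ) :
    IntegrableOn (fun t => (Real.exp (r * t) : ℂ) * g t) (Ioc a b) := by
  rw [← integrableOn_Icc_iff_integrableOn_Ioc] at hg ⊢
  exact hg.continuousOn_mul (by fun_prop) isCompact_Icc

/-- A Volterra equation of the second kind with integrable kernel and Lipschitz nonlinearity has
exactly one integrable solution, up to equality almost everywhere. -/
theorem exists_volterra_solution (hK : IntegrableOn K (Ioc 0 (b - a)))
    (hφ : IntegrableOn φ (Ioc a b))
    (hf : ∀ u : ℝ → ℂ, IntegrableOn u (Ioc a b) → IntegrableOn (fun t => f t (u t)) (Ioc a b))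
    (hL : ∀ t ∈ Ioc a b, ∀ y₁ y₂ : ℂ, ‖f t y₁ - f t y₂‖ ≤ L * ‖y₁ - y₂‖) :
    ∃ u : ℝ → ℂ, IntegrableOn u (Ioc a b) ∧
      (u =ᵐ[volume.restrict (Ioc a b)] fun t => φ t + volterra a K (fun t => f t (u t)) t) ∧
      ∀ v : ℝ → ℂ, IntegrableOn v (Ioc a b) →
        (v =ᵐ[volume.restrict (Ioc a b)] fun t => φ t + volterra a K (fun t => f t (v t)) t) →
        v =ᵐ[volume.restrict (Ioc a b)] u := by
  -- The contraction argument needs a nonnegative Lipschitz constant, hence `max L 0`.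
  obtain ⟨n, hn⟩ := exists_exp_weight_small hK (max L 0)
  set e : ℝ → ℂ := fun x => (Real.exp (-n * x) : ℂ) with he
  set e' : ℝ → ℂ := fun x => (Real.exp (n * x) : ℂ) with he'
  have hee : ∀ x, e x * e' x = 1 := fun x => by
    rw [he, he', ← Complex.ofReal_mul, ← Real.exp_add]; simp
  -- Since e(t-τ) e(τ) = e(t), multiplying the unknown by e turns K into eK. The nonlinearity
  -- becomes y ↦ e(t) f(t, y/e(t)), with the same Lipschitz constant.
  have hvol : ∀ (g : ℝ → ℂ) (t : ℝ),
      volterra a (fun x => e x * K x) (fun t => e t * g t) t = e t * volterra a K g t := by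
    intro g t
    rw [volterra, volterra, ← intervalIntegral.integral_const_mul]
    refine intervalIntegral.integral_congr fun τ _ => ?_
    have : e (t - τ) * e τ = e t := by
      rw [he, ← Complex.ofReal_mul, ← Real.exp_add]
      congr 2
      ring
    simp only [← this]
    ring
  obtain ⟨u, hu, hueq, huniq⟩ := exists_volterra_solution_of_small
    (a := a) (b := b) (K := fun x => e x * K x) (φ := fun t => e t * φ t)
    (f := fun t y => e t * f t (e' t * y)) (L := max L 0)
    (integrableOn_exp_mul hK _) (integrableOn_exp_mul hφ _)
    (fun u hu => integrableOn_exp_mul (hf _ (integrableOn_exp_mul hu _)) _)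
    (fun t ht y₁ y₂ => by
      rw [← mul_sub, norm_mul]
      calc ‖e t‖ * ‖f t (e' t * y₁) - f t (e' t * y₂)‖
          ≤ ‖e t‖ * (max L 0 * ‖e' t * y₁ - e' t * y₂‖) := by
            gcongr
            exact (hL t ht _ _).trans (by gcongr; exact le_max_left _ _)
        _ = max L 0 * (‖e t * e' t‖ * ‖y₁ - y₂‖) := by
            rw [← mul_sub, norm_mul, norm_mul]; ring
        _ = max L 0 * ‖y₁ - y₂‖ := by rw [hee]; simp) (le_max_right _ _) hn
  have hcancel : ∀ t (y : ℂ), e' t * (e t * y) = y := fun t y => by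
    rw [← mul_assoc, mul_comm (e' t), hee, one_mul]
  refine ⟨fun t => e' t * u t, integrableOn_exp_mul hu _, ?_, fun v hv hveq => ?_⟩
  · filter_upwards [hueq] with t ht
    rw [ht, hvol, ← mul_add, hcancel]
  · have := huniq (fun t => e t * v t) (integrableOn_exp_mul hv _) (by
      filter_upwards [hveq] with t ht
      simp only [hcancel]
      rw [hvol, ← mul_add, ← ht])
    filter_upwards [this] with t ht
    rw [← ht, hcancel]

end

/-! ### Reduction of the Cauchy problem to a Volterra equation -/

noncomputable section

theorem restrict_Icc_eq_restrict_Ioc (a b : ℝ) :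
    (volume : Measure ℝ).restrict (Icc a b) = volume.restrict (Ioc a b) :=
  Measure.restrict_congr_set Ioc_ae_eq_Icc.symm

/-- The points where w and g agree accumulate at a from the right, so the two limits coincide. Hence
the initial values do not depend on the chosen representative. -/
theorem ContinuousOn.eq_of_ae_eq_of_tendsto {a b : ℝ} (hab : a < b) {g w : ℝ → ℂ} {c : ℂ}
    (hg : ContinuousOn g (Icc a b)) (hw : w =ᵐ[volume.restrict (Icc a b)] g)
    (hc : Tendsto w (𝓝[>] a) (𝓝 c)) : g a = c := by
  have hg' : Tendsto g (𝓝[>] a) (𝓝 (g a)) := by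
    have := (hg a (left_mem_Icc.2 hab.le)).mono Ioc_subset_Icc_self
    rwa [ContinuousWithinAt, nhdsWithin_Ioc_eq_nhdsGT hab] at this
  refine tendsto_nhds_unique_of_frequently_eq hg' hc fun hne => ?_
  obtain ⟨e, he, hsub⟩ := (mem_nhdsGT_iff_exists_Ioo_subset).1 hne
  have he : a < e := he
  rw [EventuallyEq, ae_restrict_iff' measurableSet_Icc] at hw
  have h0 : volume (Ioo a (min e b)) = 0 := by
    refine measure_mono_null (fun x hx => ?_) hw
    have hx' : x ∈ Ioo a e := ⟨hx.1, hx.2.trans_le (min_le_left _ _)⟩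
    intro h
    exact hsub hx' (h ⟨hx.1.le, hx.2.le.trans (min_le_right _ _)⟩).symm
  rw [Real.volume_Ioo, ENNReal.ofReal_eq_zero] at h0
  have := lt_min he hab
  linarith

/-- The kernel has constant norm 1/|Γ(ν)|, so the integral is at most a multiple of ∫_a^t ‖u‖. -/
theorem tendsto_volterra_rlKernel_of_re_eq_one {a b : ℝ} (hab : a < b) {ν : ℂ} (hν : ν.re = 1)
    {u : ℝ → ℂ} (hu : IntegrableOn u (Ioc a b)) :
    Tendsto (volterra a (rlKernel ν) u) (𝓝[>] a) (𝓝 0) := by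
  have hi := intervalIntegrable_of_integrableOn_Ioc hu (right_mem_Icc.2 hab.le)
  have hc := intervalIntegral.continuousOn_primitive_interval' hi.norm left_mem_uIcc a left_mem_uIcc
  have hc : Tendsto (fun t => ∫ τ in a..t, ‖u τ‖) (𝓝[>] a) (𝓝 0) := by
    have h1 := hc.mono (Ioc_subset_Icc_self.trans (uIcc_of_le hab.le).ge)
    rw [ContinuousWithinAt, nhdsWithin_Ioc_eq_nhdsGT hab] at h1
    simpa using h1
  have hc := hc.const_mul ‖(Complex.Gamma ν)⁻¹‖
  rw [mul_zero] at hc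
  refine squeeze_zero_norm' ?_ hc
  filter_upwards [Ioc_mem_nhdsGT hab] with t ht
  rw [← intervalIntegral.integral_const_mul]
  refine intervalIntegral.norm_integral_le_of_norm_le ht.1.le ?_
    ((intervalIntegrable_of_integrableOn_Ioc hu (Ioc_subset_Icc_self ht)).norm.const_mul _)
  have hne : ∀ᵐ x : ℝ, x ≠ t := by simp [ae_iff, measure_singleton]
  filter_upwards [hne] with x hx hxI
  have h1 : 0 < t - x := sub_pos.2 (lt_of_le_of_ne hxI.2 hx)
  rw [norm_mul, rlKernel, norm_mul, norm_cpow_sub_one h1, hν, sub_self, Real.rpow_zero, mul_one]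

section Cauchy

variable {a b : ℝ} {γ : ℂ} {u : ℝ → ℂ}

/-- Lowering γ by an integer leaves the fractional integral I^(m-γ) u unchanged and only reduces the
number of derivatives taken. Its continuous representative on [a,b] is unique. -/
theorem isRLDeriv_sub_iff (hab : a < b) {v w : ℝ → ℂ}
    (hv : MemACSucc a b ⌊γ.re⌋₊ v)
    (hvu : v =ᵐ[volume.restrict (Icc a b)] rlInt a (((⌊γ.re⌋₊ + 1 : ℕ) : ℂ) - γ) u)
    {k : ℕ} (hk : k ≤ ⌊γ.re⌋₊) :
    IsRLDeriv a b (γ - ((k + 1 : ℕ) : ℂ)) u w ↔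
      w =ᵐ[volume.restrict (Icc a b)] iteratedDerivWithin (⌊γ.re⌋₊ - k) v (Icc a b) := by
  have hre : (γ - ((k + 1 : ℕ) : ℂ)).re = γ.re - ((k + 1 : ℕ) : ℝ) := by
    rw [Complex.sub_re, Complex.natCast_re]
  rw [IsRLDeriv]
  by_cases h0 : 0 ≤ (γ - ((k + 1 : ℕ) : ℂ)).re
  · have hkl : k + 1 ≤ ⌊γ.re⌋₊ := Nat.le_floor (by rw [hre] at h0; linarith)
    have hfl : ⌊(γ - ((k + 1 : ℕ) : ℂ)).re⌋₊ = ⌊γ.re⌋₊ - (k + 1) := by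
      rw [hre, Nat.floor_sub_natCast]
    have hord : (((⌊γ.re⌋₊ - (k + 1) + 1 : ℕ) : ℂ)) - (γ - ((k + 1 : ℕ) : ℂ)) =
        ((⌊γ.re⌋₊ + 1 : ℕ) : ℂ) - γ := by
      have : (((⌊γ.re⌋₊ - (k + 1) + 1 : ℕ) : ℂ)) + ((k + 1 : ℕ) : ℂ) =
          ((⌊γ.re⌋₊ + 1 : ℕ) : ℂ) := by
        rw [← Nat.cast_add]
        congr 1
        omega
      rw [← this]
      ring
    have hidx : ⌊γ.re⌋₊ - (k + 1) + 1 = ⌊γ.re⌋₊ - k := by omega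
    rw [hfl, hord, hidx]
    constructor
    · rintro ⟨h1, -⟩
      obtain ⟨v', hv', hvu', hw⟩ := h1 h0
      have heq : EqOn v' v (Icc a b) :=
        Measure.eqOn_Icc_of_ae_eq volume hab.ne (hvu'.trans hvu.symm)
          hv'.1.continuousOn hv.1.continuousOn
      refine hw.trans ?_
      filter_upwards [ae_restrict_mem measurableSet_Icc] with x hx
      exact iteratedDerivWithin_congr heq hx
    · intro hw
      exact ⟨fun _ => ⟨v, hv.mono hab (Nat.sub_le _ _), hvu, hw⟩, fun h => absurd h h0.not_gt⟩
  -- The order is negative only for the last k, where no derivative is left and the definition by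
  -- I^(-ν) gives I^(m-γ) u itself.
  · have hlk : ⌊γ.re⌋₊ = k := by
      refine le_antisymm ?_ hk
      rw [hre] at h0
      have h1 : γ.re < ((k + 1 : ℕ) : ℝ) := by linarith
      have := (Nat.floor_lt' (Nat.succ_ne_zero k)).2 h1
      omega
    have hord : -(γ - ((k + 1 : ℕ) : ℂ)) = ((⌊γ.re⌋₊ + 1 : ℕ) : ℂ) - γ := by
      rw [hlk]; ring
    rw [hord, hlk, Nat.sub_self, iteratedDerivWithin_zero]
    rw [hlk] at hvu
    constructor
    · rintro ⟨-, h2⟩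
      exact (h2 (not_le.1 h0)).trans hvu.symm
    · intro hw
      exact ⟨fun h => absurd h h0, fun _ => hw.trans hvu⟩

/-- The initial data of the Cauchy problem, extended by zero. -/
def initialData (γ : ℂ) (C : ℕ → ℂ) (k : ℕ) : ℂ := if k ≤ ⌈γ.re⌉₊ then C k else 0

theorem isCauchySolution_iff_rlInt (hab : a < b) (hγ : 0 ≤ γ.re) (C : ℕ → ℂ)
    (hu : IntegrableOn u (Ioc a b)) {w : ℝ → ℂ} (hw : IntegrableOn w (Ioc a b)) :
    (IsRLDeriv a b γ u w ∧ ∀ k ∈ Finset.Icc 1 ⌈γ.re⌉₊, ∃ w' : ℝ → ℂ,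
      IsRLDeriv a b (γ - (k : ℂ)) u w' ∧ Tendsto w' (𝓝[>] a) (𝓝 (C k))) ↔
    rlInt a (((⌊γ.re⌋₊ + 1 : ℕ) : ℂ) - γ) u =ᵐ[volume.restrict (Icc a b)]
      iterPrim a (initialData γ C) w (⌊γ.re⌋₊ + 1) := by
  constructor
  · rintro ⟨⟨h1, -⟩, h2⟩
    obtain ⟨v, hv, hvu, hwv⟩ := h1 hγ
    have hcont : ∀ k, ContinuousOn (iteratedDerivWithin (⌊γ.re⌋₊ - k) v (Icc a b)) (Icc a b) :=
      fun k => hv.1.continuousOn_iteratedDerivWithin (by exact_mod_cast Nat.sub_le _ _)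
        (uniqueDiffOn_Icc hab)
    have hd : ∀ k ≤ ⌊γ.re⌋₊, iteratedDerivWithin (⌊γ.re⌋₊ - k) v (Icc a b) a =
        initialData γ C (k + 1) := by
      intro k hk
      rw [initialData]
      split_ifs with hkn
      · obtain ⟨w', hw', hlim⟩ := h2 (k + 1) (Finset.mem_Icc.2 ⟨by omega, hkn⟩)
        exact (hcont k).eq_of_ae_eq_of_tendsto hab ((isRLDeriv_sub_iff hab hv hvu hk).1 hw') hlim
      -- No value is prescribed only if Re γ is an integer and k = m - 1. Then Re(m-γ) = 1, so
      -- I^(m-γ) u tends to 0, in agreement with the extension of the data by zero.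
      · have hkl : k = ⌊γ.re⌋₊ := by
          have := Nat.floor_le_ceil γ.re
          omega
        subst hkl
        have hint : γ.re = ⌊γ.re⌋₊ := by
          refine le_antisymm ?_ (Nat.floor_le hγ)
          exact Nat.ceil_le.1 (by omega)
        refine (hcont _).eq_of_ae_eq_of_tendsto hab (w := rlInt a (((⌊γ.re⌋₊ + 1 : ℕ) : ℂ) - γ) u)
          ?_ ?_
        · simpa using hvu.symm
        · rw [rlInt_eq_volterra]
          refine tendsto_volterra_rlKernel_of_re_eq_one hab ?_ hu
          rw [Complex.sub_re, Complex.natCast_re]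
          push_cast
          linarith
    have heq := hv.iteratedDerivWithin_eq_iterPrim hab hw hwv hd le_rfl
    rw [Nat.sub_self, iteratedDerivWithin_zero] at heq
    refine hvu.symm.trans ?_
    filter_upwards [ae_restrict_mem measurableSet_Icc] with x hx using heq hx
  · intro h
    have hv := memACSucc_iterPrim hab (initialData γ C) hw ⌊γ.re⌋₊
    refine ⟨⟨fun _ => ⟨_, hv, h.symm, ae_eq_iteratedDerivWithin_iterPrim hab _ hw _⟩,
      fun h => absurd h hγ.not_gt⟩, fun k hk => ?_⟩
    obtain ⟨hk1, hkn⟩ := Finset.mem_Icc.1 hk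
    obtain ⟨k, rfl⟩ : ∃ j, k = j + 1 := ⟨k - 1, by omega⟩
    have hkl : k ≤ ⌊γ.re⌋₊ := by
      have := Nat.ceil_le_floor_add_one γ.re
      omega
    refine ⟨_, (isRLDeriv_sub_iff hab hv h.symm hkl).2 EventuallyEq.rfl, ?_⟩
    have he := iteratedDerivWithin_iterPrim hab (initialData γ C) hw (⌊γ.re⌋₊ - k) k
    rw [show k + (⌊γ.re⌋₊ - k) + 1 = ⌊γ.re⌋₊ + 1 by omega] at he
    have hc := (continuousOn_iterPrim hab.le (initialData γ C) hw k) a (left_mem_Icc.2 hab.le)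
    have hc := hc.mono Ioc_subset_Icc_self
    rw [ContinuousWithinAt, nhdsWithin_Ioc_eq_nhdsGT hab] at hc
    have hval : iterPrim a (initialData γ C) w (k + 1) a = C (k + 1) := by
      simp [iterPrim_succ_apply, initialData, hkn]
    rw [hval] at hc
    refine hc.congr' ?_
    filter_upwards [Ioc_mem_nhdsGT hab] with x hx
    exact (he (Ioc_subset_Icc_self hx)).symm

theorem initialPart_initialData (a : ℝ) (γ : ℂ) (C : ℕ → ℂ) (ζ : ℂ) :
    initialPart a (⌊γ.re⌋₊ + 1) (initialData γ C) ζ =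
      initialPart a ⌈γ.re⌉₊ (initialData γ C) ζ := by
  ext t
  have h1 := Nat.ceil_le_floor_add_one γ.re
  refine (Finset.sum_subset (Finset.range_subset_range.2 h1) fun k _ hk => ?_).symm
  have : ¬ k + 1 ≤ ⌈γ.re⌉₊ := by rw [Finset.mem_range] at hk; omega
  simp [initialData, this]

/-- I^(m-γ) maps the right-hand side of the Volterra equation to the iterated primitive, and it is
injective on L^1. -/
theorem rlInt_ae_eq_iterPrim_iff (hab : a < b) (hγ : 0 ≤ γ.re) (C : ℕ → ℂ)
    (hu : IntegrableOn u (Ioc a b)) {k K F : ℝ → ℂ} (hF : IntegrableOn F (Ioc a b))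
    (hk : IntegrableOn k (Ioc 0 (b - a))) (hK : IntegrableOn K (Ioc 0 (b - a)))
    (hkK : volterra 0 (rlKernel (((⌊γ.re⌋₊ + 1 : ℕ) : ℂ) - γ)) K
      =ᵐ[volume.restrict (Ioc 0 (b - a))] volterra 0 (rlKernel ((⌊γ.re⌋₊ + 1 : ℕ) : ℂ)) k) :
    rlInt a (((⌊γ.re⌋₊ + 1 : ℕ) : ℂ) - γ) u =ᵐ[volume.restrict (Ioc a b)]
      iterPrim a (initialData γ C) (volterra a k F) (⌊γ.re⌋₊ + 1) ↔
    u =ᵐ[volume.restrict (Ioc a b)]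
      fun t => initialPart a ⌈γ.re⌉₊ (initialData γ C) γ t + volterra a K F t := by
  set m : ℕ := ⌊γ.re⌋₊ + 1 with hm
  have hμ : 0 < ((m : ℂ) - γ).re := by
    have := Nat.lt_floor_add_one γ.re
    rw [Complex.sub_re, Complex.natCast_re, hm]
    push_cast
    linarith
  have hm0 : 0 < (m : ℂ).re := by rw [Complex.natCast_re, hm]; positivity
  have hζ : (⌈γ.re⌉₊ : ℝ) - 1 < γ.re := by linarith [Nat.ceil_lt_add_one hγ]
  have hφ := integrableOn_initialPart (a := a) b (initialData γ C) hζ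
  have hKF := integrableOn_volterra hK hF
  have key : volterra a (rlKernel ((m : ℂ) - γ))
      (fun t => initialPart a ⌈γ.re⌉₊ (initialData γ C) γ t + volterra a K F t)
      =ᵐ[volume.restrict (Ioc a b)] iterPrim a (initialData γ C) (volterra a k F) m := by
    have hrl := integrableOn_rlKernel hμ (b - a)
    filter_upwards [volterra_add hrl hφ hKF, volterra_assoc hrl hK hF,
      volterra_assoc (integrableOn_rlKernel hm0 (b - a)) hk hF,
      volterra_rlKernel_initialPart (a := a) b (initialData γ C) hμ hζ,
      iterPrim_ae_eq (initialData γ C) (integrableOn_volterra hk hF) ⌊γ.re⌋₊,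
      ae_restrict_mem measurableSet_Ioc] with t h1 h2 h3 h4 h5 ht
    have hm' : ((⌊γ.re⌋₊ : ℂ) + 1) = (m : ℂ) := by rw [hm]; push_cast; rfl
    rw [h1, h2, h4, h5, hm', volterra_congr_left _ hkK (Ioc_subset_Icc_self ht), ← h3,
      initialPart_initialData, sub_add_cancel, add_comm]
  rw [rlInt_eq_volterra]
  constructor
  · intro h
    exact ae_eq_of_volterra_rlKernel hab hμ hu (hφ.add hKF) (h.trans key.symm)
  · intro h
    refine EventuallyEq.trans ?_ key
    filter_upwards [ae_restrict_mem measurableSet_Ioc] with t ht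
    exact volterra_congr_right _ h (Ioc_subset_Icc_self ht)

end Cauchy

theorem im_volterra_eq_zero {a b : ℝ} {K g : ℝ → ℂ} (hK : ∀ x ∈ Ioc 0 (b - a), (K x).im = 0)
    (hg : ∀ t, (g t).im = 0) {t : ℝ} (ht : t ∈ Ioc a b) : (volterra a K g t).im = 0 := by
  have : volterra a K g t = ((∫ τ in Ioo a t, (K (t - τ) * g τ).re : ℝ) : ℂ) := by
    rw [volterra, intervalIntegral.integral_of_le ht.1.le, integral_Ioc_eq_integral_Ioo,
      ← integral_complex_ofReal]
    refine setIntegral_congr_fun measurableSet_Ioo fun τ hτ => ?_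
    refine Complex.ext rfl ?_
    rw [Complex.ofReal_im]
    exact im_mul_eq_zero (hK _ ⟨sub_pos.2 hτ.2, by linarith [hτ.1, ht.2]⟩) (hg τ)
  rw [this, Complex.ofReal_im]

theorem im_initialPart_eq_zero {a : ℝ} {γ : ℂ} (hγ : γ.im = 0) {C : ℕ → ℂ}
    (hC : ∀ k ∈ Finset.Icc 1 ⌈γ.re⌉₊, (C k).im = 0) {t : ℝ} (ht : a ≤ t) :
    (initialPart a ⌈γ.re⌉₊ (initialData γ C) γ t).im = 0 := by
  rw [initialPart, Complex.im_sum]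
  refine Finset.sum_eq_zero fun k hk => im_mul_eq_zero ?_
    (im_rlKernel_eq_zero (by simpa) (sub_nonneg.2 ht))
  have hk := Finset.mem_range.1 hk
  rw [initialData, if_pos (by omega)]
  exact hC _ (Finset.mem_Icc.2 ⟨by omega, by omega⟩)

/-- The Cauchy problem is equivalent to a Volterra equation of the second kind, with a real kernel
and a real inhomogeneity if all the data are real. -/
theorem exists_volterra_equation {a b : ℝ} (hab : a < b) {α β γ : ℂ}
    (hα : 0 ≤ α.re) (hβ : 0 ≤ β.re) (hγ : 0 ≤ γ.re) {R : ℝ} (hR : (b - a) ^ β.re < R)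
    {A : ℂ → ℂ} {c : ℕ → ℂ}
    (hA : ∀ x ∈ Metric.ball (0 : ℂ) R, HasSum (fun n : ℕ => c n * x ^ n) (A x))
    (hker : 0 < α.re ∨ IntegrableOn (genKernel A α β) (Ioo 0 (b - a))) (C : ℕ → ℂ) :
    ∃ K φ : ℝ → ℂ, IntegrableOn K (Ioc 0 (b - a)) ∧ IntegrableOn φ (Ioc a b) ∧
      (∀ (f : ℝ → ℂ → ℂ) (u : ℝ → ℂ), IntegrableOn u (Ioc a b) →
        IntegrableOn (fun t => f t (u t)) (Ioc a b) →
        (IsCauchySolution a b A α β γ C f u ↔ u =ᵐ[volume.restrict (Ioc a b)]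
          fun t => φ t + volterra a K (fun t => f t (u t)) t)) ∧
      ((α.im = 0 ∧ β.im = 0 ∧ γ.im = 0 ∧ (∀ n, (c n).im = 0) ∧
        ∀ k ∈ Finset.Icc 1 ⌈γ.re⌉₊, (C k).im = 0) →
        (∀ x ∈ Ioc 0 (b - a), (K x).im = 0) ∧ ∀ t ∈ Ioc a b, (φ t).im = 0) := by
  have hlt : γ.re < ((⌊γ.re⌋₊ + 1 : ℕ) : ℝ) := by
    push_cast
    exact Nat.lt_floor_add_one γ.re
  obtain ⟨hk, K, hK, hkK, hKr⟩ := exists_kernel (sub_pos.2 hab) hα hβ hγ hlt hR hA hker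
  refine ⟨K, initialPart a ⌈γ.re⌉₊ (initialData γ C) γ, hK,
    integrableOn_initialPart b _ (by linarith [Nat.ceil_lt_add_one hγ]), fun f u hu hF => ?_, ?_⟩
  · have h1 := isCauchySolution_iff_rlInt hab hγ C hu (integrableOn_volterra hk hF)
    rw [restrict_Icc_eq_restrict_Ioc, rlInt_ae_eq_iterPrim_iff hab hγ C hu hF hk hK hkK] at h1
    exact h1
  · rintro ⟨h1, h2, h3, h4, h5⟩
    exact ⟨hKr h1 h2 h3 h4, fun t ht => im_initialPart_eq_zero h3 h5 ht.1.le⟩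

/-- Reality is read off the equation itself: φ, K and all values of f are real, whatever the
argument of f is. -/
theorem exists_cauchySolution {a b : ℝ} (hab : a < b) {α β γ : ℂ}
    (hα : 0 ≤ α.re) (hβ : 0 ≤ β.re) (hγ : 0 ≤ γ.re) {R : ℝ} (hR : (b - a) ^ β.re < R)
    {A : ℂ → ℂ} {c : ℕ → ℂ}
    (hA : ∀ x ∈ Metric.ball (0 : ℂ) R, HasSum (fun n : ℕ => c n * x ^ n) (A x))
    (hker : 0 < α.re ∨ IntegrableOn (genKernel A α β) (Ioo 0 (b - a))) (C : ℕ → ℂ) {L : ℝ}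
    {f : ℝ → ℂ → ℂ}
    (hf : ∀ u : ℝ → ℂ, IntegrableOn u (Ioc a b) → IntegrableOn (fun t => f t (u t)) (Ioc a b))
    (hL : ∀ t ∈ Ioc a b, ∀ y₁ y₂ : ℂ, ‖f t y₁ - f t y₂‖ ≤ L * ‖y₁ - y₂‖) :
    ∃ u : ℝ → ℂ, IntegrableOn u (Ioc a b) ∧
      (∀ v : ℝ → ℂ, IntegrableOn v (Ioc a b) →
        (IsCauchySolution a b A α β γ C f v ↔ v =ᵐ[volume.restrict (Ioc a b)] u)) ∧
      ((α.im = 0 ∧ β.im = 0 ∧ γ.im = 0 ∧ (∀ n, (c n).im = 0) ∧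
        ∀ k ∈ Finset.Icc 1 ⌈γ.re⌉₊, (C k).im = 0) → (∀ t z, (f t z).im = 0) →
        ∀ᵐ t ∂volume.restrict (Ioc a b), (u t).im = 0) := by
  obtain ⟨K, φ, hK, hφ, hiff, hreal⟩ := exists_volterra_equation hab hα hβ hγ hR hA hker C
  obtain ⟨u, hu, hueq, huniq⟩ := exists_volterra_solution hK hφ hf hL
  refine ⟨u, hu, fun v hv => ⟨fun h => huniq v hv ((hiff f v hv (hf v hv)).1 h), fun h => ?_⟩,
    fun hr hfr => ?_⟩
  · rw [hiff f v hv (hf v hv)]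
    have hF : (fun t => f t (v t)) =ᵐ[volume.restrict (Ioc a b)] fun t => f t (u t) := by
      filter_upwards [h] with t ht
      rw [ht]
    filter_upwards [h, hueq, ae_restrict_mem measurableSet_Ioc] with t h1 h2 ht
    rw [volterra_congr_right _ hF (Ioc_subset_Icc_self ht), ← h2, h1]
  · obtain ⟨hKr, hφr⟩ := hreal hr
    filter_upwards [hueq, ae_restrict_mem measurableSet_Ioc] with t h1 ht
    rw [h1, Complex.add_im, hφr t ht, im_volterra_eq_zero hKr (fun τ => hfr τ _) ht, add_zero]

end

/-! ### The theorem for classes in L^1, complex and real -/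

theorem mainTheorem12 (a b : ℝ) (hab : a < b) (α β γ : ℂ)
    (hα : 0 ≤ α.re) (hβ : 0 ≤ β.re) (hγ : 0 ≤ γ.re)
    (R : ℝ) (hR : (b - a) ^ β.re < R)
    (A : ℂ → ℂ) (c : ℕ → ℂ)
    (hA : ∀ x ∈ Metric.ball (0 : ℂ) R, HasSum (fun n : ℕ => c n * x ^ n) (A x))
    (hker : 0 < α.re ∨ IntegrableOn (genKernel A α β) (Ioo 0 (b - a)))
    (C : ℕ → ℂ) (L : ℝ) :
    (∀ f : ℝ → ℂ → ℂ,
      (∀ u : ℝ → ℂ, IntegrableOn u (Icc a b) → IntegrableOn (fun t => f t (u t)) (Icc a b)) →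
      (∀ t ∈ Icc a b, ∀ y₁ y₂ : ℂ, ‖f t y₁ - f t y₂‖ ≤ L * ‖y₁ - y₂‖) →
      ∃! u : Lp ℂ 1 (volume.restrict (Icc a b)), IsCauchySolution a b A α β γ C f u) ∧
    ((α.im = 0 ∧ β.im = 0 ∧ γ.im = 0 ∧ (∀ n, (c n).im = 0) ∧
        ∀ k ∈ Finset.Icc 1 ⌈γ.re⌉₊, (C k).im = 0) →
      ∀ f : ℝ → ℝ → ℝ,
      (∀ u : ℝ → ℝ, IntegrableOn u (Icc a b) → IntegrableOn (fun t => f t (u t)) (Icc a b)) →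
      (∀ t ∈ Icc a b, ∀ y₁ y₂ : ℝ, |f t y₁ - f t y₂| ≤ L * |y₁ - y₂|) →
      ∃! u : Lp ℝ 1 (volume.restrict (Icc a b)),
        IsCauchySolution a b A α β γ C (fun t z => (f t z.re : ℂ)) (fun t => (u t : ℂ))) := by
  constructor
  · intro f hf hL
    simp only [IntegrableOn, restrict_Icc_eq_restrict_Ioc] at hf
    obtain ⟨u, hu, hiff, -⟩ := exists_cauchySolution hab hα hβ hγ hR hA hker C hf
      fun t ht => hL t (Ioc_subset_Icc_self ht)
    have hu' : Integrable u (volume.restrict (Icc a b)) := by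
      rwa [restrict_Icc_eq_restrict_Ioc]
    have hi : ∀ v : Lp ℂ 1 (volume.restrict (Icc a b)), IntegrableOn v (Ioc a b) := fun v =>
      IntegrableOn.mono_set (L1.integrable_coeFn v) Ioc_subset_Icc_self
    refine ⟨hu'.toL1 u, ?_, fun v hv => ?_⟩
    · refine (hiff _ (hi _)).2 ?_
      rw [← restrict_Icc_eq_restrict_Ioc]
      exact hu'.coeFn_toL1
    · have h1 := (hiff v (hi v)).1 hv
      rw [← restrict_Icc_eq_restrict_Ioc] at h1
      exact Lp.ext (h1.trans hu'.coeFn_toL1.symm)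
  · intro hr f hf hL
    simp only [IntegrableOn, restrict_Icc_eq_restrict_Ioc] at hf
    -- The real f is extended to complex arguments by z ↦ f(t, Re z), which is Lipschitz because |Re
    -- z| ≤ |z|. The complex solution is real almost everywhere, so its real part is the required
    -- class.
    obtain ⟨u, hu, hiff, hur⟩ := exists_cauchySolution hab hα hβ hγ hR hA hker C
      (f := fun t z => (f t z.re : ℂ)) (L := max L 0)
      (fun u hu => (hf _ hu.re).ofReal) fun t ht y₁ y₂ => by
        rw [← Complex.ofReal_sub, Complex.norm_real, Real.norm_eq_abs]
        refine (hL t (Ioc_subset_Icc_self ht) _ _).trans ?_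
        rw [← Complex.sub_re]
        exact mul_le_mul (le_max_left _ _) (Complex.abs_re_le_norm _) (abs_nonneg _)
          (le_max_right _ _)
    have hur := hur hr fun t z => Complex.ofReal_im _
    have hu' : Integrable (fun t => (u t).re) (volume.restrict (Icc a b)) := by
      rw [restrict_Icc_eq_restrict_Ioc]
      exact hu.re
    have hi : ∀ v : Lp ℝ 1 (volume.restrict (Icc a b)),
        IntegrableOn (fun t => (v t : ℂ)) (Ioc a b) := fun v =>
      Integrable.ofReal (IntegrableOn.mono_set (L1.integrable_coeFn v) Ioc_subset_Icc_self)
    refine ⟨hu'.toL1 _, ?_, fun v hv => ?_⟩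
    · refine (hiff _ (hi _)).2 ?_
      rw [← restrict_Icc_eq_restrict_Ioc] at hur ⊢
      filter_upwards [hu'.coeFn_toL1, hur] with t h2 h3
      rw [h2]
      exact Complex.ext (Complex.ofReal_re _) (by rw [Complex.ofReal_im, h3])
    · have h1 := (hiff _ (hi v)).1 hv
      rw [← restrict_Icc_eq_restrict_Ioc] at h1
      refine Lp.ext ?_
      filter_upwards [h1, hu'.coeFn_toL1] with t h2 h3
      rw [h3, ← h2, Complex.ofReal_re]
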